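/- **Setting.** Let $\mathcal A$ be a (possibly non-unital) $C^*$-algebra, $\mathcal B$ a unital $C^*$-algebra, $\mathbf V$ a right $\mathcal A$-module, $G$ a group, $U$ a representation of $G$ on $\mathbf V$ by $\mathcal A$-linear bijections, and $\beta$ an action of $G$ on $\mathcal B$ by $*$-automorphisms. Let $S_{\mathcal A}(\mathbf V)$ be the vector space of $\mathcal A$-sesquilinear forms $s:\mathbf V\times\mathbf V\to\mathcal A$, that is, $s$ is conjugate linear in the first and linear in the second variable, $s(u,va)=s(u,v)a$ and $s(ua,v)=a^*s(u,v)$. Fix a positive form $s_1\in S_{\mathcal A}(\mathbf V)$ (i.e. $s_1(v,v)\ge 0$ for all $v$). Let $\mathbf{CP}^U_\beta(s_1)$ be the convex set of linear maps $S:\mathcal B\to S_{\mathcal A}(\mathbf V)$, $b\mapsto S_b$, such that * $\sum_{j,k=1}^n S_{b_j^*b_k}(v_j,v_k)\ge 0$ for all $n$, $b_j\in\mathcal B$, $v_j\in\mathbf V$ (complete positivity), * $S_{\beta_g(b)}(v,w)=S_b\big(U(g^{-1})v,U(g^{-1})w\big)$ for all $g,b,v,w$ (covariance), * $S_{1_{\mathcal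 B}}=s_1$. For a Hilbert $\mathcal A$-module $\mathbf M$ let $\mathcal L_{\mathcal A}(\mathbf M)$ be the algebra of adjointable bounded $\mathcal A$-linear operators on $\mathbf M$; $\mathbf M$ is *self-dual* if every bounded $\mathcal A$-linear map $\mathbf M\to\mathcal A$ is of the form $\langle m|\cdot\rangle$ for some $m\in\mathbf M$. A *covariant dilation* of $S$ is a quadruple $(\mathbf M,\pi,J,\tilde U)$ of a Hilbert $\mathcal A$-module $\mathbf M$, a unital $*$-homomorphism $\pi:\mathcal B\to\mathcal L_{\mathcal A}(\mathbf M)$, an $\mathcal A$-linear map $J:\mathbf V\to\mathbf M$ and a representation $\tilde U$ of $G$ by unitaries of $\mathcal L_{\mathcal A}(\mathbf M)$ such that $S_b(v,w)=\langle Jv|\pi(b)Jw\rangle$, $JU(g)=\tilde U(g)J$ and $\tilde U(g)\pi(b)=\pi(\beta_g(b))\tilde U(g)$ for all $b,v,w,g$. It is *minimal* if $\mathrm{lin}_{\mathbb C}\{\pi(b)Jv\mid b\in\mathcal B,\ v\in\mathbf V\}$ is norm dense in $\mathbf M$. When $\mathcal A$ is a $W^*$-algebra, it is *$W^*$-minimal*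 if $\mathbf M$ is self-dual and this linear span is dense in $\mathbf M$ for the topology given by the seminorms $m\mapsto\sqrt{\varphi(\langle m|m\rangle)}$ or for the topology given by the seminorms $m\mapsto|\varphi(\langle m'|m\rangle)|$, where $\varphi$ runs through the normal positive functionals on $\mathcal A$ and $m'$ through $\mathbf M$. When $\mathcal A$ and $\mathcal B$ are $W^*$-algebras, let $\mathbf{NCP}^U_\beta(s_1)$ be the set of those $S\in\mathbf{CP}^U_\beta(s_1)$ for which $b\mapsto S_b(v,v)$ is normal for every $v\in\mathbf V$, i.e. preserves the suprema of bounded increasing nets of self-adjoint elements. For a covariant dilation $(\mathbf M,\pi,J,\tilde U)$ consider the condition $(\ast)$ if $D\in\mathcal L_{\mathcal A}(\mathbf M)$ satisfies $[D,\pi(b)]=0$ for all $b\in\mathcal B$, $[D,\tilde U(g)]=0$ for all $g\in G$, and $\langle Jv|DJv\rangle=0$ for all $v\in\mathbf V$, then $D=0$. **Theorem.** Let $S\in\mathbf{CP}^U_\beta(s_1)$. 1. Let $(\mathbf M,\pi,J,\tilde U)$ be a minimal covariant dilation of $S$. If $S$ is an extreme point of $\mathbf{CP}^U_\beta(s_1)$,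 then $(\ast)$ holds. If $\mathbf M$ is self-dual, then conversely $(\ast)$ implies that $S$ is an extreme point of $\mathbf{CP}^U_\beta(s_1)$. 2. Suppose that $\mathcal A$ is a $W^*$-algebra and let $(\mathbf L,\pi,J,\tilde U)$ be a $W^*$-minimal covariant dilation of $S$. Then $S$ is an extreme point of $\mathbf{CP}^U_\beta(s_1)$ if and only if $(\ast)$ holds for $(\mathbf L,\pi,J,\tilde U)$. 3. Suppose that $\mathcal A$ and $\mathcal B$ are $W^*$-algebras and $S\in\mathbf{NCP}^U_\beta(s_1)$. Then $S$ is an extreme point of $\mathbf{NCP}^U_\beta(s_1)$ if and only if it is an extreme point of $\mathbf{CP}^U_\beta(s_1)$. -/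

import Mathlib

open scoped ComplexOrder

noncomputable section

namespace CovCP

universe u

open MulOpposite

/-! ### Right modules over a (possibly non-unital) C⋆-algebra -/

/-- The right action `v a` of `a : A` on `v` is the scalar action `op a • v` of the opposite
algebra. This is the usual notion of a complex right `A`-module, for `A` possibly non-unital. -/
class IsRightModule (A V : Type*) [NonUnitalCStarAlgebra A] [AddCommGroup V] [Module ℂ V]
    [SMul Aᵐᵒᵖ V] : Prop where
  act_add (v w : V) (a : A) : op a • (v + w) = op a • v + op a • w
  add_act (v : V) (a b : A) : op (a + b) • v = op a • v + op b • v
  act_mul (v : V) (a b : A) : op (a * b) • v = op b • (op a • v)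
  act_complex_smul (c : ℂ) (v : V) (a : A) : op a • (c • v) = c • (op a • v)
  complex_smul_act (c : ℂ) (v : V) (a : A) : op (c • a) • v = c • (op a • v)

/-- Compatibility with the right actions of `A`: `T (v a) = (T v) a`. -/
def IsModuleMap (A : Type*) {V W : Type*} [SMul Aᵐᵒᵖ V] [SMul Aᵐᵒᵖ W] (T : V → W) : Prop :=
  ∀ (v : V) (a : A), T (op a • v) = op a • T v

/-! ### `A`-sesquilinear forms -/

section Sesq

variable (A V : Type*) [NonUnitalCStarAlgebra A] [AddCommGroup V] [Module ℂ V] [SMul Aᵐᵒᵖ V]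

/-- The complex vector space of `A`-sesquilinear forms on `V`, conjugate linear in the first and
linear in the second variable. -/
def SesqForm : Submodule ℂ (V →ₗ⋆[ℂ] V →ₗ[ℂ] A) where
  carrier := {s | (∀ u v (a : A), s u (op a • v) = s u v * a) ∧
    ∀ u v (a : A), s (op a • u) v = star a * s u v}
  add_mem' := by
    rintro s t ⟨hs, hs'⟩ ⟨ht, ht'⟩
    exact ⟨fun u v a => by simp [hs, ht, add_mul], fun u v a => by simp [hs', ht', mul_add]⟩
  zero_mem' := by simp
  smul_mem' := by
    rintro c s ⟨hs, hs'⟩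
    exact ⟨fun u v a => by simp [hs, smul_mul_assoc], fun u v a => by simp [hs', mul_smul_comm]⟩

variable {A V}

/-- `s v v ≥ 0` for all `v`. -/
def SesqForm.IsPositive [PartialOrder A] (s : SesqForm A V) : Prop :=
  ∀ v, 0 ≤ s.1 v v

end Sesq

/-! ### Normal maps and W⋆-algebras -/

/-- `f` preserves the suprema of bounded increasing nets of self-adjoint elements. -/
def IsNormalMap {B C : Type*} [Star B] [Preorder B] [Preorder C] (f : B → C) : Prop :=
  ∀ D : Set B, D.Nonempty → DirectedOn (· ≤ ·) D → (∀ b ∈ D, IsSelfAdjoint b) →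
    ∀ s, IsLUB D s → IsLUB (f '' D) (f s)

/-- A W⋆-algebra is a C⋆-algebra which is ⋆-isomorphic to a von Neumann algebra on some Hilbert
space (in particular it is unital). -/
def IsWStarAlgebra (A : Type u) [NonUnitalCStarAlgebra A] : Prop :=
  ∃ (H : Type u) (_ : NormedAddCommGroup H) (_ : InnerProductSpace ℂ H) (_ : CompleteSpace H)
    (N : VonNeumannAlgebra H), Nonempty (A ≃⋆ₐ[ℂ] N.toStarSubalgebra)

/-! ### Hilbert modules

Mathlib's `CStarModule A M` is written for left actions, `⟪x, a • y⟫ = a * ⟪x, y⟫`. A right Hilbert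
module over `A` is therefore a complete space `M` with `CStarModule Aᵐᵒᵖ M`; the axioms of a right
module hold automatically because the inner product is non-degenerate. -/

section Hilbert

variable (A : Type*) [NonUnitalCStarAlgebra A] [PartialOrder A] [StarOrderedRing A]
  {M : Type*} [NormedAddCommGroup M] [NormedSpace ℂ M] [SMul Aᵐᵒᵖ M] [CStarModule Aᵐᵒᵖ M]

/-- The `A`-valued inner product `⟨x|y⟩` of a right Hilbert `A`-module. -/
def ip (x y : M) : A := unop (inner Aᵐᵒᵖ x y)

/-- `T'` is an adjoint of `T`. -/
def IsAdjointPair (T T' : M →L[ℂ] M) : Prop :=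
  ∀ x y : M, ip A x (T y) = ip A (T' x) y

/-- `T` belongs to the algebra of bounded adjointable `A`-linear operators on `M`. -/
def IsAdjointable (T : M →L[ℂ] M) : Prop :=
  IsModuleMap A T ∧ ∃ T' : M →L[ℂ] M, IsModuleMap A T' ∧ IsAdjointPair A T T'

/-- `T` is a unitary element of the algebra of adjointable operators on `M`. -/
def IsUnitaryOp (T : M →L[ℂ] M) : Prop :=
  IsModuleMap A T ∧ ∃ T' : M →L[ℂ] M, IsModuleMap A T' ∧ IsAdjointPair A T T' ∧
    T * T' = 1 ∧ T' * T = 1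

variable (M)

/-- Every bounded `A`-linear map `M → A` is of the form `⟨m|·⟩`. -/
def IsSelfDual : Prop :=
  ∀ f : M →L[ℂ] A, (∀ (x : M) (a : A), f (op a • x) = f x * a) → ∃ m : M, ∀ x, f x = ip A m x

/-- The topology given by the seminorms `x ↦ √φ(⟨x|x⟩)`, with `φ` running through the normal
positive linear functionals on `A`. -/
@[reducible]
def tau₁ : TopologicalSpace M :=
  TopologicalSpace.generateFrom
    {O | ∃ (φ : A →ₚ[ℂ] ℂ) (x₀ : M) (ε : ℝ), IsNormalMap φ ∧
      O = {x | √(φ (ip A (x - x₀) (x - x₀))).re < ε}}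

/-- The topology given by the seminorms `x ↦ |φ(⟨y|x⟩)|`, with `φ` running through the normal
positive linear functionals on `A` and `y` through `M`. -/
@[reducible]
def tau₂ : TopologicalSpace M :=
  TopologicalSpace.generateFrom
    {O | ∃ (φ : A →ₚ[ℂ] ℂ) (y x₀ : M) (ε : ℝ), IsNormalMap φ ∧
      O = {x | ‖φ (ip A y (x - x₀))‖ < ε}}

end Hilbert

/-! ### Covariant completely positive maps and their dilations -/

section CP

variable {A B V G : Type*} [NonUnitalCStarAlgebra A] [PartialOrder A] [StarOrderedRing A]
  [CStarAlgebra B] [AddCommGroup V] [Module ℂ V] [SMul Aᵐᵒᵖ V] [Group G]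

/-- Complete positivity of a linear map from `B` to the `A`-sesquilinear forms on `V`. -/
def IsCP (S : B →ₗ[ℂ] SesqForm A V) : Prop :=
  ∀ (n : ℕ) (b : Fin n → B) (v : Fin n → V),
    0 ≤ ∑ j, ∑ k, (S (star (b j) * b k)).1 (v j) (v k)

/-- `(β, U)`-covariance. -/
def IsCovariant (β : G →* (B ≃⋆ₐ[ℂ] B)) (U : G →* (V ≃ₗ[ℂ] V)) (S : B →ₗ[ℂ] SesqForm A V) : Prop :=
  ∀ g b v w, (S (β g b)).1 v w = (S b).1 (U g⁻¹ v) (U g⁻¹ w)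

/-- The covariant CP maps `S` with `S 1 = s₁`. -/
def CP (β : G →* (B ≃⋆ₐ[ℂ] B)) (U : G →* (V ≃ₗ[ℂ] V)) (s₁ : SesqForm A V) :
    Set (B →ₗ[ℂ] SesqForm A V) :=
  {S | IsCP S ∧ IsCovariant β U S ∧ S 1 = s₁}

/-- The normal covariant CP maps `S` with `S 1 = s₁`. -/
def NCP [PartialOrder B] (β : G →* (B ≃⋆ₐ[ℂ] B)) (U : G →* (V ≃ₗ[ℂ] V)) (s₁ : SesqForm A V) :
    Set (B →ₗ[ℂ] SesqForm A V) :=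
  {S | S ∈ CP β U s₁ ∧ ∀ v : V, IsNormalMap fun b : B => (S b).1 v v}

/-- A covariant dilation of `S` on the Hilbert module `M`, without any minimality requirement. -/
structure CovariantDilation (β : G →* (B ≃⋆ₐ[ℂ] B)) (U : G →* (V ≃ₗ[ℂ] V))
    (S : B →ₗ[ℂ] SesqForm A V) (M : Type*) [NormedAddCommGroup M] [NormedSpace ℂ M]
    [SMul Aᵐᵒᵖ M] [CStarModule Aᵐᵒᵖ M] where
  /-- the unital ⋆-homomorphism into the adjointable operators -/
  π : B →ₐ[ℂ] (M →L[ℂ] M)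
  π_module : ∀ b, IsModuleMap A (π b)
  π_star : ∀ b, IsAdjointPair A (π b) (π (star b))
  /-- the `A`-linear map from `V` to `M` -/
  J : V →ₗ[ℂ] M
  J_module : IsModuleMap A J
  /-- the unitary representation of `G` -/
  Ut : G →* (M →L[ℂ] M)
  Ut_unitary : ∀ g, IsUnitaryOp A (Ut g)
  dilates : ∀ b v w, (S b).1 v w = ip A (J v) (π b (J w))
  J_covariant : ∀ g v, J (U g v) = Ut g (J v)
  π_covariant : ∀ g b, Ut g * π b = π (β g b) * Ut g

namespace CovariantDilation

variable {β : G →* (B ≃⋆ₐ[ℂ] B)} {U : G →* (V ≃ₗ[ℂ] V)} {S : B →ₗ[ℂ] SesqForm A V}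
  {M : Type*} [NormedAddCommGroup M] [NormedSpace ℂ M] [SMul Aᵐᵒᵖ M] [CStarModule Aᵐᵒᵖ M]

/-- The linear span of the vectors `π(b)Jv`. -/
def range (d : CovariantDilation β U S M) : Submodule ℂ M :=
  Submodule.span ℂ {x | ∃ b v, x = d.π b (d.J v)}

/-- Minimality: the vectors `π(b)Jv` span a norm dense subspace. -/
def IsMinimal (d : CovariantDilation β U S M) : Prop :=
  Dense (d.range : Set M)

/-- W⋆-minimality: `M` is self-dual and the vectors `π(b)Jv` span a subspace which is dense for
the first, respectively the second, of the topologies above (either is allowed). -/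
def IsWStarMinimal (d : CovariantDilation β U S M) : Prop :=
  IsSelfDual A M ∧
    (@Dense M (tau₁ A M) (d.range : Set M) ∨ @Dense M (tau₂ A M) (d.range : Set M))

/-- The only adjointable `D` commuting with `π(B)` and `Ũ(G)` and with `⟨Jv|DJv⟩ = 0` for all `v`
is `D = 0`. -/
def ExtremalityCondition (d : CovariantDilation β U S M) : Prop :=
  ∀ D : M →L[ℂ] M, IsAdjointable A D → (∀ b, Commute D (d.π b)) → (∀ g, Commute D (d.Ut g)) →
    (∀ v, ip A (d.J v) (D (d.J v)) = 0) → D = 0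

end CovariantDilation

end CP

end CovCP

end

open scoped ComplexOrder

noncomputable section

namespace CovCP

universe u

open MulOpposite

/-! An extreme point is one that cannot be perturbed, and the perturbations of S are governed by the
commutant of π and Ũ. Minimality, norm or W*, enters the operator arguments through totality
(`IsTotal`): only 0 is orthogonal to the span N of the vectors π(b)Jv.

Extremality implies (∗): the real and imaginary parts of D again satisfy the hypotheses of (∗). For
self-adjoint D and small t > 0, compressing 1 ± tD yields two elements of the convex set with
midpoint S. Extremality makes them equal to S, so the matrix elements of D on N vanish
(`eq_zero_of_extreme_of_symmetric`).

The converse is a Radon–Nikodym argument. If tR + t'R' = S, then R is dominated by t⁻¹S and induces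
a bounded hermitian form on N (`exists_form`). This form is implemented by an adjointable D
(`exists_operator_of_form`) commuting with π and Ũ; since R and S agree at 1, condition (∗) applied
to D − 1 gives R = S (`eq_of_dominated`).

Passing from form to operator requires bounded A-linear functionals on N to be represented by
vectors of M. For norm dense N they extend by continuity. Over a W*-algebra they are approximated on
finite sets with the help of resolvents, and a weak limit along an ultrafilter is represented by
self-duality (`hasRepresentation_of_isWStarAlgebra`). Finally, positive maps dominated by a normal
map are normal, so the normal maps form a face. -/

set_option linter.unusedSectionVars false

/-! ### The inner product of a right Hilbert module. -/

section IpBasic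

variable (A : Type*) [NonUnitalCStarAlgebra A] [PartialOrder A] [StarOrderedRing A]
  {M : Type*} [NormedAddCommGroup M] [NormedSpace ℂ M] [SMul Aᵐᵒᵖ M] [CStarModule Aᵐᵒᵖ M]

lemma star_ip (x y : M) : star (ip A x y) = ip A y x :=
  congrArg unop (CStarModule.star_inner (A := Aᵐᵒᵖ) x y)

lemma ip_add_right (x y z : M) : ip A x (y + z) = ip A x y + ip A x z := by simp [ip]

lemma ip_add_left (x y z : M) : ip A (x + y) z = ip A x z + ip A y z := by simp [ip]

lemma ip_smul_right (c : ℂ) (x y : M) : ip A x (c • y) = c • ip A x y := by simp [ip]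

lemma ip_smul_left (c : ℂ) (x y : M) : ip A (c • x) y = star c • ip A x y := by
  rw [← star_ip, ip_smul_right, star_smul, star_ip]

lemma ip_zero_right (x : M) : ip A x 0 = 0 := by simp [ip]

lemma ip_zero_left (x : M) : ip A 0 x = 0 := by simp [ip]

lemma ip_sub_right (x y z : M) : ip A x (y - z) = ip A x y - ip A x z := by simp [ip]

lemma ip_sub_left (x y z : M) : ip A (x - y) z = ip A x z - ip A y z := by simp [ip]

lemma ip_act_right (x y : M) (a : A) : ip A x (op a • y) = ip A x y * a := by simp [ip]

lemma ip_act_left (x y : M) (a : A) : ip A (op a • x) y = star a * ip A x y := by simp [ip]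

lemma ip_sum_right {ι : Type*} (s : Finset ι) (x : M) (y : ι → M) :
    ip A x (∑ i ∈ s, y i) = ∑ i ∈ s, ip A x (y i) := by simp [ip]

lemma ip_sum_left {ι : Type*} (s : Finset ι) (x : ι → M) (y : M) :
    ip A (∑ i ∈ s, x i) y = ∑ i ∈ s, ip A (x i) y := by simp [ip]

lemma ip_self_nonneg (x : M) : 0 ≤ ip A x x :=
  (CStarModule.inner_self_nonneg : 0 ≤ inner Aᵐᵒᵖ x x)

variable {A} in
lemma eq_zero_of_ip_self {x : M} (h : ip A x x = 0) : x = 0 :=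
  (CStarModule.inner_self (A := Aᵐᵒᵖ)).1 (unop_injective h)

lemma norm_sq_eq (x : M) : ‖x‖ ^ 2 = ‖ip A x x‖ := CStarModule.norm_sq_eq Aᵐᵒᵖ

lemma norm_ip_le (x y : M) : ‖ip A x y‖ ≤ ‖x‖ * ‖y‖ := CStarModule.norm_inner_le (A := Aᵐᵒᵖ) M

variable {A} in
lemma ext_ip_left {x y : M} (h : ∀ z, ip A z x = ip A z y) : x = y :=
  sub_eq_zero.1 (eq_zero_of_ip_self (A := A) (by rw [ip_sub_right, h, sub_self]))

variable {A} in
lemma ext_ip_right {x y : M} (h : ∀ z, ip A x z = ip A y z) : x = y :=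
  sub_eq_zero.1 (eq_zero_of_ip_self (A := A) (by rw [ip_sub_left, h, sub_self]))

/-- The operator `y ↦ ⟨x|y⟩` as a bounded linear map. -/
def ipL (x : M) : M →L[ℂ] A :=
  LinearMap.mkContinuous
    { toFun := ip A x
      map_add' := ip_add_right A x
      map_smul' := fun c y => ip_smul_right A c x y } ‖x‖ (norm_ip_le A x)

@[simp] lemma ipL_apply (x y : M) : ipL A x y = ip A x y := rfl

-- Taking y = x gives ‖x‖² ≤ C‖x‖. This turns the bound of a functional into a bound on the vector
-- representing it.
variable {A} in
lemma norm_le_of_ip_le {x : M} {C : ℝ} (hC : 0 ≤ C) (h : ∀ y, ‖ip A x y‖ ≤ C * ‖y‖) : ‖x‖ ≤ C := by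
  have h1 := h x
  rw [← norm_sq_eq, sq] at h1
  rcases (norm_nonneg x).eq_or_lt with h0 | h0
  · rwa [← h0]
  · exact le_of_mul_le_mul_right h1 h0

variable {A} in
lemma norm_le_of_ip_self_le {x y : M} {C : ℝ} (hC : 0 ≤ C)
    (h : ip A x x ≤ (C ^ 2 : ℝ) • ip A y y) : ‖x‖ ≤ C * ‖y‖ := by
  have h1 := CStarAlgebra.norm_le_norm_of_nonneg_of_le (ip_self_nonneg A x) h
  rw [norm_smul, ← norm_sq_eq, ← norm_sq_eq, Real.norm_of_nonneg (by positivity), ← mul_pow] at h1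
  exact le_of_sq_le_sq h1 (by positivity)

/-! The module axioms are consequences of the non-degeneracy of the inner product. -/

lemma act_add (x y : M) (a : A) : op a • (x + y) = op a • x + op a • y :=
  ext_ip_left (A := A) fun z => by simp [ip_act_right, ip_add_right, add_mul]

lemma act_smul (c : ℂ) (x : M) (a : A) : op a • (c • x) = c • (op a • x) :=
  ext_ip_left (A := A) fun z => by simp [ip_act_right, ip_smul_right, smul_mul_assoc]

lemma add_act (x : M) (a b : A) : op (a + b) • x = op a • x + op b • x :=
  ext_ip_left (A := A) fun z => by
    rw [ip_act_right, ip_add_right, ip_act_right, ip_act_right, mul_add]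

lemma smul_act (c : ℂ) (x : M) (a : A) : op (c • a) • x = c • (op a • x) :=
  ext_ip_left (A := A) fun z => by
    rw [ip_act_right, ip_smul_right, ip_act_right, mul_smul_comm]

lemma act_zero (a : A) : op a • (0 : M) = 0 :=
  ext_ip_left (A := A) fun z => by simp [ip_act_right, ip_zero_right]

lemma norm_act_le (x : M) (a : A) : ‖op a • x‖ ≤ ‖x‖ * ‖a‖ := by
  refine norm_le_of_ip_le (A := A) (by positivity) fun y => ?_
  rw [ip_act_left]
  calc ‖star a * ip A x y‖ ≤ ‖star a‖ * ‖ip A x y‖ := norm_mul_le _ _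
    _ ≤ ‖a‖ * (‖x‖ * ‖y‖) := by rw [norm_star]; gcongr; exact norm_ip_le A x y
    _ = ‖x‖ * ‖a‖ * ‖y‖ := by ring

lemma continuous_act (a : A) : Continuous fun x : M => op a • x := by
  let f : M →L[ℂ] M := LinearMap.mkContinuous
    { toFun := fun x => op a • x
      map_add' := fun x y => act_add A x y a
      map_smul' := fun c x => act_smul A c x a } ‖a‖ fun x => by
        rw [mul_comm]; exact norm_act_le A x a
  exact f.continuous

end IpBasic

/-! ### Adjoint pairs and order estimates for symmetric operators. -/

section Operators

variable {A : Type*} [NonUnitalCStarAlgebra A] [PartialOrder A] [StarOrderedRing A]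
  {M : Type*} [NormedAddCommGroup M] [NormedSpace ℂ M] [SMul Aᵐᵒᵖ M] [CStarModule Aᵐᵒᵖ M]

lemma IsAdjointPair.symm {T T' : M →L[ℂ] M} (h : IsAdjointPair A T T') :
    IsAdjointPair A T' T := fun x y => by
  rw [← star_ip, ← h y x, star_ip]

/-- An operator with an adjoint is `A`-linear. -/
lemma IsAdjointPair.isModuleMap {T T' : M →L[ℂ] M} (h : IsAdjointPair A T T') :
    IsModuleMap A T := fun x a =>
  ext_ip_left (A := A) fun z => by rw [h, ip_act_right, ip_act_right, h]

lemma IsAdjointPair.isAdjointable {T T' : M →L[ℂ] M} (h : IsAdjointPair A T T') :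
    IsAdjointable A T :=
  ⟨h.isModuleMap, T', h.symm.isModuleMap, h⟩

lemma IsAdjointPair.add {T T' R R' : M →L[ℂ] M} (h : IsAdjointPair A T T')
    (k : IsAdjointPair A R R') : IsAdjointPair A (T + R) (T' + R') := fun x y => by
  simp only [add_apply, ip_add_left, ip_add_right, h x y, k x y]

lemma IsAdjointPair.smul {T T' : M →L[ℂ] M} (h : IsAdjointPair A T T') (c : ℂ) :
    IsAdjointPair A (c • T) (star c • T') := fun x y => by
  simp only [smul_apply, ip_smul_left, ip_smul_right, h x y, star_star]

lemma IsAdjointPair.sub {T T' R R' : M →L[ℂ] M} (h : IsAdjointPair A T T')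
    (k : IsAdjointPair A R R') : IsAdjointPair A (T - R) (T' - R') := fun x y => by
  simp only [sub_apply, ip_sub_left, ip_sub_right, h x y, k x y]

lemma IsAdjointPair.mul {T T' R R' : M →L[ℂ] M} (h : IsAdjointPair A T T')
    (k : IsAdjointPair A R R') : IsAdjointPair A (T * R) (R' * T') := fun x y => by
  simp only [mul_apply_eq_comp, h x, k _ y]

lemma isAdjointPair_one : IsAdjointPair A (1 : M →L[ℂ] M) 1 := fun _ _ => rfl

lemma IsAdjointPair.unique {T T' T'' : M →L[ℂ] M} (h : IsAdjointPair A T T')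
    (k : IsAdjointPair A T T'') : T' = T'' :=
  ContinuousLinearMap.ext fun x => ext_ip_right (A := A) fun y => by rw [← h, k]

lemma IsAdjointPair.eq_zero {T : M →L[ℂ] M} (h : IsAdjointPair A T 0) : T = 0 :=
  h.symm.unique (fun x y => by simp [ip_zero_right, ip_zero_left])

/-- If `T` commutes with `R`, its adjoint commutes with the adjoint of `R`. -/
lemma IsAdjointPair.commute {T T' R R' : M →L[ℂ] M} (h : IsAdjointPair A T T')
    (k : IsAdjointPair A R R') (c : Commute T R) : Commute T' R' := by
  have h1 := h.mul k
  rw [c.eq] at h1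
  exact ((k.mul h).unique h1)

/-- A symmetric contraction is dominated by the identity. -/
lemma ip_apply_le_of_norm_le_one {T : M →L[ℂ] M} (h : IsAdjointPair A T T) (hT : ‖T‖ ≤ 1) (x : M) :
    ip A x (T x) ≤ ip A x x := by
  -- Expanding ⟨x − Rx|x − Rx⟩ ≥ 0 bounds ⟨x|Rx⟩ by the mean of ⟨x|x⟩ and ⟨x|R²x⟩. Iterating over R
  -- = T^(2^n) leaves a remainder of weight 2⁻ⁿ, bounded because T is a contraction. Completeness of
  -- M is not needed.
  have step : ∀ R : M →L[ℂ] M, IsAdjointPair A R R →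
      ip A x (R x) ≤ (2⁻¹ : ℝ) • (ip A x x + ip A x ((R ^ 2) x)) := by
    intro R hR
    have h0 := ip_self_nonneg A (x - R x)
    have e : ip A (x - R x) (x - R x)
        = ip A x x + ip A x ((R ^ 2) x) - (2 : ℝ) • ip A x (R x) := by
      rw [sq, mul_apply_eq_comp, hR x (R x), ip_sub_left, ip_sub_right, ip_sub_right,
        ← hR x x, two_smul]
      abel
    rw [e, sub_nonneg] at h0
    have := smul_le_smul_of_nonneg_left h0 (by norm_num : (0 : ℝ) ≤ 2⁻¹)
    rwa [smul_smul, inv_mul_cancel₀ two_ne_zero, one_smul] at this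
  have hpow : ∀ n : ℕ, IsAdjointPair A (T ^ n) (T ^ n) := by
    intro n
    induction n with
    | zero => simpa using! (isAdjointPair_one (A := A) (M := M))
    | succ n ih =>
      have := ih.mul h
      rwa [← pow_succ, ← pow_succ'] at this
  have main : ∀ n : ℕ, ip A x (T x) ≤
      (1 - (2⁻¹ : ℝ) ^ n) • ip A x x + ((2⁻¹ : ℝ) ^ n) • ip A x ((T ^ 2 ^ n) x) := by
    intro n
    induction n with
    | zero => simp
    | succ n ih =>
      refine ih.trans ?_
      have h1 := smul_le_smul_of_nonneg_left (step _ (hpow (2 ^ n)))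
        (by positivity : (0 : ℝ) ≤ (2⁻¹ : ℝ) ^ n)
      refine (add_le_add_right h1 _).trans (le_of_eq ?_)
      rw [← pow_mul, ← pow_succ]
      module
  have hlim : Filter.Tendsto (fun n : ℕ => (1 - (2⁻¹ : ℝ) ^ n) • ip A x x
      + ((2⁻¹ : ℝ) ^ n) • ip A x ((T ^ 2 ^ n) x)) Filter.atTop (nhds (ip A x x)) := by
    have h2 : Filter.Tendsto (fun n : ℕ => (2⁻¹ : ℝ) ^ n) Filter.atTop (nhds 0) :=
      tendsto_pow_atTop_nhds_zero_of_lt_one (by norm_num) (by norm_num)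
    have h3 : Filter.Tendsto (fun n : ℕ => (1 - (2⁻¹ : ℝ) ^ n) • ip A x x) Filter.atTop
        (nhds (ip A x x)) := by
      have := (tendsto_const_nhds (x := (1 : ℝ)).sub h2).smul_const (ip A x x)
      simpa using this
    have h4 : Filter.Tendsto (fun n : ℕ => ((2⁻¹ : ℝ) ^ n) • ip A x ((T ^ 2 ^ n) x)) Filter.atTop
        (nhds 0) := by
      refine squeeze_zero_norm (a := fun n : ℕ => (2⁻¹ : ℝ) ^ n * (‖x‖ * ‖x‖)) (fun n => ?_) ?_
      · rw [norm_smul, Real.norm_of_nonneg (by positivity)]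
        gcongr
        refine (norm_ip_le A _ _).trans ?_
        gcongr
        refine ((T ^ 2 ^ n).le_opNorm x).trans ?_
        have : ‖T ^ 2 ^ n‖ ≤ 1 :=
          (norm_pow_le' _ (by positivity)).trans (pow_le_one₀ (norm_nonneg _) hT)
        nlinarith [norm_nonneg x]
      · simpa using h2.mul_const (‖x‖ * ‖x‖)
    simpa using h3.add h4
  exact ge_of_tendsto' hlim main

lemma ip_apply_le {T : M →L[ℂ] M} (h : IsAdjointPair A T T) (x : M) {c : ℝ} (hc : 0 < c)
    (hT : ‖T‖ ≤ c) : ip A x (T x) ≤ c • ip A x x := by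
  have h1 : IsAdjointPair A (((c⁻¹ : ℝ) : ℂ) • T) (((c⁻¹ : ℝ) : ℂ) • T) := by
    simpa using! h.smul ((c⁻¹ : ℝ) : ℂ)
  have h2 := ip_apply_le_of_norm_le_one h1 (by
    rw [norm_smul, Complex.norm_real, norm_inv, Real.norm_of_nonneg hc.le]
    exact inv_mul_le_one_of_le₀ hT hc.le) x
  rw [smul_apply, ip_smul_right, Complex.coe_smul] at h2
  have := smul_le_smul_of_nonneg_left h2 hc.le
  rwa [smul_smul, mul_inv_cancel₀ hc.ne', one_smul] at this

end Operators

/-! ### Total subspaces. -/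

section Orthogonal

variable (A : Type*) [NonUnitalCStarAlgebra A] [PartialOrder A] [StarOrderedRing A]
  {M : Type*} [NormedAddCommGroup M] [NormedSpace ℂ M] [SMul Aᵐᵒᵖ M] [CStarModule Aᵐᵒᵖ M]

/-- Only `0` is orthogonal to all of `N`. -/
def IsTotal (N : Submodule ℂ M) : Prop :=
  ∀ z : M, (∀ x ∈ N, ip A z x = 0) → z = 0

variable {A}

lemma isTotal_of_dense {N : Submodule ℂ M} (hN : Dense (N : Set M)) : IsTotal A N := by
  intro z hz
  have h : (fun x => ip A z x) = fun _ => 0 :=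
    Continuous.ext_on hN (ipL A z).continuous continuous_const hz
  exact eq_zero_of_ip_self (A := A) (congrFun h z)

lemma IsTotal.ext {N : Submodule ℂ M} (hN : IsTotal A N) {y z : M}
    (h : ∀ x ∈ N, ip A x y = ip A x z) : y = z :=
  sub_eq_zero.1 <| hN _ fun x hx => by
    rw [← star_ip, ip_sub_right, h x hx, sub_self, star_zero]

/-- An adjointable operator which vanishes on a total subspace is zero. -/
lemma IsTotal.eq_zero {N : Submodule ℂ M} (hN : IsTotal A N) {T T' : M →L[ℂ] M}
    (hT : IsAdjointPair A T T') (h : ∀ x ∈ N, T x = 0) : T = 0 := by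
  have h' : T' = 0 := ContinuousLinearMap.ext fun y => hN _ fun x hx => by
    rw [← hT, h x hx, ip_zero_right]
  subst h'
  exact hT.eq_zero

end Orthogonal

section Sesq

variable {A V : Type*} [NonUnitalCStarAlgebra A] [AddCommGroup V] [Module ℂ V]

/-- A sesquilinear form which vanishes on the diagonal is zero. -/
lemma sesq_eq_zero_of_diag (s : V →ₗ⋆[ℂ] V →ₗ[ℂ] A) (h : ∀ v, s v v = 0) (v w : V) :
    s v w = 0 := by
  have h1 := h (v + w)
  have h2 := h (v + Complex.I • w)
  simp only [map_add, LinearMap.add_apply, h, zero_add, add_zero, LinearMap.map_smulₛₗ,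
    LinearMap.smul_apply, map_smul, Complex.conj_I, smul_zero] at h1 h2
  have h3 : s v w = -s w v := by rw [eq_neg_iff_add_eq_zero, add_comm]; exact h1
  rw [h3, neg_smul, smul_neg, ← neg_add, neg_eq_zero, ← two_smul ℂ, smul_smul] at h2
  have h4 : s w v = 0 := (smul_eq_zero.1 h2).resolve_left (by simp)
  rw [h3, h4, neg_zero]

end Sesq

/-! ### Extremality implies the commutant condition. -/

namespace CovariantDilation

variable {A B V G : Type*} [NonUnitalCStarAlgebra A] [PartialOrder A] [StarOrderedRing A]
  [CStarAlgebra B] [AddCommGroup V] [Module ℂ V] [SMul Aᵐᵒᵖ V] [Group G]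
  {β : G →* (B ≃⋆ₐ[ℂ] B)} {U : G →* (V ≃ₗ[ℂ] V)} {S : B →ₗ[ℂ] SesqForm A V}
  {M : Type*} [NormedAddCommGroup M] [NormedSpace ℂ M] [SMul Aᵐᵒᵖ M] [CStarModule Aᵐᵒᵖ M]

lemma Ut_mul_inv (d : CovariantDilation β U S M) (g : G) (x : M) :
    d.Ut g (d.Ut g⁻¹ x) = x := by
  rw [← mul_apply_eq_comp, ← map_mul, mul_inv_cancel, map_one, one_apply_eq_self]

lemma Ut_adjoint (d : CovariantDilation β U S M) (g : G) :
    IsAdjointPair A (d.Ut g) (d.Ut g⁻¹) := by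
  obtain ⟨-, T', -, hT, h1, -⟩ := d.Ut_unitary g
  have : T' = d.Ut g⁻¹ := by
    calc T' = d.Ut g⁻¹ * (d.Ut g * T') := by
          rw [← mul_assoc, ← map_mul, inv_mul_cancel, map_one, one_mul]
      _ = d.Ut g⁻¹ := by rw [h1, mul_one]
  rwa [← this]

lemma mem_range (d : CovariantDilation β U S M) (b : B) (v : V) : d.π b (d.J v) ∈ d.range :=
  Submodule.subset_span ⟨b, v, rfl⟩

/-- The map `b ↦ ⟨J · | π(b) D J ·⟩` into the sesquilinear forms. -/
def compress (d : CovariantDilation β U S M) (D : M →L[ℂ] M) (hD : IsModuleMap A D) :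
    B →ₗ[ℂ] SesqForm A V where
  toFun b := ⟨LinearMap.mk₂'ₛₗ (starRingEnd ℂ) (RingHom.id ℂ)
      (fun v w => ip A (d.J v) (d.π b (D (d.J w))))
      (fun v v' w => by rw [map_add, ip_add_left])
      (fun c v w => by rw [map_smul, ip_smul_left]; rfl)
      (fun v w w' => by rw [map_add, map_add, map_add, ip_add_right])
      (fun c v w => by rw [map_smul, map_smul, map_smul, ip_smul_right]; rfl),
    fun u v a => by
      simp only [LinearMap.mk₂'ₛₗ_apply]
      rw [d.J_module, hD, d.π_module, ip_act_right],
    fun u v a => by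
      simp only [LinearMap.mk₂'ₛₗ_apply]
      rw [d.J_module, ip_act_left]⟩
  map_add' b c := by
    ext v w
    simp [ip_add_right]
  map_smul' c b := by
    ext v w
    simp [ip_smul_right]

lemma compress_apply (d : CovariantDilation β U S M) {D : M →L[ℂ] M} (hD : IsModuleMap A D)
    (b : B) (v w : V) : (d.compress D hD b).1 v w = ip A (d.J v) (d.π b (D (d.J w))) := rfl

/-- Since D commutes with π, the sum in the definition of complete positivity is ⟨x|Dx⟩ for x = ∑
π(b_k)Jv_k. -/
lemma compress_isCP (d : CovariantDilation β U S M) {D : M →L[ℂ] M} (hD : IsModuleMap A D)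
    (hpos : ∀ x, 0 ≤ ip A x (D x)) (hπ : ∀ b, Commute D (d.π b)) : IsCP (d.compress D hD) := by
  intro n b v
  have h := hpos (∑ k, d.π (b k) (d.J (v k)))
  convert h using 1
  rw [map_sum, ip_sum_left]
  refine Finset.sum_congr rfl fun j _ => ?_
  rw [ip_sum_right]
  refine Finset.sum_congr rfl fun k _ => ?_
  rw [compress_apply, map_mul, mul_apply_eq_comp, d.π_star, star_star]
  congr 1
  exact (DFunLike.congr_fun (hπ (b k)).eq (d.J (v k))).symm

lemma compress_isCovariant (d : CovariantDilation β U S M) {D : M →L[ℂ] M}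
    (hD : IsModuleMap A D) (hU : ∀ g, Commute D (d.Ut g)) :
    IsCovariant β U (d.compress D hD) := by
  intro g b v w
  rw [compress_apply, compress_apply, d.J_covariant, d.J_covariant, ← d.Ut_adjoint g]
  have h1 : d.Ut g (d.π b (D (d.Ut g⁻¹ (d.J w)))) = d.π (β g b) (d.Ut g (D (d.Ut g⁻¹ (d.J w)))) :=
    DFunLike.congr_fun (d.π_covariant g b) _
  have h2 : d.Ut g (D (d.Ut g⁻¹ (d.J w))) = D (d.Ut g (d.Ut g⁻¹ (d.J w))) :=
    (DFunLike.congr_fun (hU g).eq _).symm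
  rw [h1, h2, d.Ut_mul_inv]

/-- Perturbing `S` by a symmetric contraction in the commutant. -/
lemma eq_zero_of_extreme_of_symmetric (d : CovariantDilation β U S M) {s₁ : SesqForm A V}
    (hS : S ∈ (CP β U s₁).extremePoints ℝ) (hN : IsTotal A d.range) {D : M →L[ℂ] M}
    (hD : IsAdjointPair A D D) (hπ : ∀ b, Commute D (d.π b)) (hU : ∀ g, Commute D (d.Ut g))
    (hJ : ∀ v, ip A (d.J v) (D (d.J v)) = 0) : D = 0 := by
  have hmod : IsModuleMap A D := hD.isModuleMap
  -- With t = (1 + ‖D‖)⁻¹, each cD with |c| ≤ t is a symmetric contraction, so 1 + cD is positive.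
  obtain ⟨t, ht, htD⟩ : ∃ t : ℝ, 0 < t ∧ ‖(t : ℂ) • D‖ ≤ 1 := by
    refine ⟨(1 + ‖D‖)⁻¹, by positivity, ?_⟩
    rw [norm_smul, Complex.norm_real, Real.norm_of_nonneg (by positivity)]
    exact inv_mul_le_one_of_le₀ (by linarith) (by positivity)
  have key : ∀ c : ℝ, |c| ≤ t → ∃ h : IsModuleMap A (1 + (c : ℂ) • D : M →L[ℂ] M),
      d.compress (1 + (c : ℂ) • D) h ∈ CP β U s₁ := by
    intro c hc
    have hcD : IsAdjointPair A ((c : ℂ) • D) ((c : ℂ) • D) := by simpa using! hD.smul (c : ℂ)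
    have hsum := isAdjointPair_one.add hcD
    refine ⟨hsum.isModuleMap, compress_isCP d _ (fun x => ?_) (fun b => ?_),
      compress_isCovariant d _ (fun g => ?_), ?_⟩
    · have hneg : IsAdjointPair A ((-1 : ℂ) • ((c : ℂ) • D)) ((-1 : ℂ) • ((c : ℂ) • D)) := by
        simpa using! hcD.smul (-1)
      have := ip_apply_le_of_norm_le_one hneg (by
        rw [norm_smul, norm_neg, norm_one, one_mul]
        refine le_trans ?_ htD
        rw [norm_smul, norm_smul, Complex.norm_real, Complex.norm_real, Real.norm_eq_abs,
          Real.norm_of_nonneg ht.le]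
        gcongr) x
      rw [smul_apply, ip_smul_right, neg_smul, one_smul, neg_le_iff_add_nonneg'] at this
      rwa [add_apply, ip_add_right, one_apply_eq_self, add_comm]
    · exact (Commute.one_left _).add_left ((hπ b).smul_left _)
    · exact (Commute.one_left _).add_left ((hU g).smul_left _)
    · have hS1 : S 1 = s₁ := hS.1.2.2
      ext v w
      rw [compress_apply, map_one, ← hS1, d.dilates, map_one]
      simp only [one_apply_eq_self, add_apply, smul_apply, ip_add_right, ip_smul_right]
      -- The normalization at 1 is unchanged: ⟨J·|DJ·⟩ vanishes on the diagonal, hence everywhere by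
      -- polarization.
      have h0 := sesq_eq_zero_of_diag (d.compress D hmod 1).1
        (fun v => by rw [compress_apply, map_one, one_apply_eq_self, hJ v]) v w
      rw [compress_apply, map_one, one_apply_eq_self] at h0
      rw [h0, smul_zero, add_zero]
  obtain ⟨h1, m1⟩ := key t (abs_of_pos ht).le
  obtain ⟨h2, m2⟩ := key (-t) (by rw [abs_neg, abs_of_pos ht])
  -- S is the midpoint of the perturbations by tD and −tD.
  have heq := ((mem_extremePoints.1 hS).2 _ m1 _ m2 ⟨1 / 2, 1 / 2, by norm_num, by norm_num,
    by norm_num, by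
      ext b v w
      have e : (((1 / 2 : ℝ) • d.compress (1 + (t : ℂ) • D) h1
          + (1 / 2 : ℝ) • d.compress (1 + ((-t : ℝ) : ℂ) • D) h2) b).1 v w
          = (1 / 2 : ℝ) • (d.compress (1 + (t : ℂ) • D) h1 b).1 v w
          + (1 / 2 : ℝ) • (d.compress (1 + ((-t : ℝ) : ℂ) • D) h2 b).1 v w := rfl
      rw [e, compress_apply, compress_apply, d.dilates]
      simp only [add_apply, smul_apply, one_apply_eq_self, map_add, map_smul, ip_add_right,
        ip_smul_right, Complex.ofReal_neg]
      module⟩).1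
  have hz : ∀ b v w, ip A (d.J v) (d.π b (D (d.J w))) = 0 := by
    intro b v w
    have h3 : (d.compress (1 + (t : ℂ) • D) h1 b).1 v w = (S b).1 v w := by rw [heq]
    rw [compress_apply, d.dilates] at h3
    simp only [add_apply, smul_apply, one_apply_eq_self, map_add, map_smul, ip_add_right,
        ip_smul_right, add_eq_left] at h3
    exact (smul_eq_zero.1 h3).resolve_left (by exact_mod_cast ht.ne')
  refine hN.eq_zero hD fun x hx => ?_
  refine hN.ext fun y hy => ?_
  rw [ip_zero_right]
  induction hx using Submodule.span_induction with
  | zero => rw [map_zero, ip_zero_right]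
  | add x x' _ _ h h' => rw [map_add, ip_add_right, h, h', add_zero]
  | smul c x _ h => rw [map_smul, ip_smul_right, h, smul_zero]
  | mem x hx =>
    obtain ⟨b, v, rfl⟩ := hx
    induction hy using Submodule.span_induction with
    | zero => rw [ip_zero_left]
    | add x x' _ _ h h' => rw [ip_add_left, h, h', add_zero]
    | smul c x _ h => rw [ip_smul_left, h, smul_zero]
    | mem y hy =>
      obtain ⟨c, w, rfl⟩ := hy
      -- Commuting D past π(b) and moving π(c) across the inner product turns the matrix element
      -- into one of the form `hz`, at c*b.
      have h4 := hz (star c * b) w v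
      rw [map_mul, mul_apply_eq_comp, d.π_star, star_star] at h4
      rw [← h4]
      congr 1
      exact DFunLike.congr_fun (hπ b).eq (d.J v)

/-- If `S` is extreme and the vectors `π(b)Jv` are total, the extremality condition holds. -/
theorem extremalityCondition_of_extreme (d : CovariantDilation β U S M) {s₁ : SesqForm A V}
    (hS : S ∈ (CP β U s₁).extremePoints ℝ) (hN : IsTotal A d.range) :
    d.ExtremalityCondition := by
  rintro D ⟨-, D', -, hD⟩ hπ hU hJ
  have hπ' : ∀ b, Commute D' (d.π b) := fun b => by
    have := hD.commute (d.π_star (star b)) (hπ (star b))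
    rwa [star_star] at this
  have hU' : ∀ g, Commute D' (d.Ut g) := fun g => by
    have := hD.commute (d.Ut_adjoint g⁻¹) (hU g⁻¹)
    rwa [inv_inv] at this
  have hJ' : ∀ v, ip A (d.J v) (D' (d.J v)) = 0 := fun v => by
    rw [← star_ip, ← hD, hJ, star_zero]
  -- D + D' and i(D − D') are symmetric and inherit all the hypotheses. Their vanishing gives D = D'
  -- and 2D = 0.
  have hp : IsAdjointPair A (D + D') (D + D') := by
    have := hD.add hD.symm
    rwa [add_comm D' D] at this
  have hm : IsAdjointPair A (Complex.I • (D - D')) (Complex.I • (D - D')) := by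
    have := (hD.sub hD.symm).smul Complex.I
    have e : star Complex.I • (D' - D) = Complex.I • (D - D') := by
      simp [← smul_neg]
    rwa [e] at this
  have h1 := d.eq_zero_of_extreme_of_symmetric hS hN hp (fun b => (hπ b).add_left (hπ' b))
    (fun g => (hU g).add_left (hU' g)) (fun v => by rw [add_apply, ip_add_right, hJ, hJ', add_zero])
  have h2 := d.eq_zero_of_extreme_of_symmetric hS hN hm
    (fun b => ((hπ b).sub_left (hπ' b)).smul_left _)
    (fun g => ((hU g).sub_left (hU' g)).smul_left _)
    (fun v => by rw [smul_apply, sub_apply, ip_smul_right, ip_sub_right, hJ, hJ', sub_zero,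
      smul_zero])
  have h3 : D = D' := sub_eq_zero.1 ((smul_eq_zero.1 h2).resolve_left Complex.I_ne_zero)
  rw [← h3, ← two_smul ℂ] at h1
  exact (smul_eq_zero.1 h1).resolve_left two_ne_zero

end CovariantDilation

/-! ### Polarization, hermiticity and boundedness of A-valued forms. -/

section SesqBounds

variable {A E : Type*} [NonUnitalCStarAlgebra A] [AddCommGroup E] [Module ℂ E]

lemma sesq_smul_left (Q : E →ₗ⋆[ℂ] E →ₗ[ℂ] A) (c : ℂ) (x y : E) :
    Q (c • x) y = star c • Q x y := by
  rw [LinearMap.map_smulₛₗ, LinearMap.smul_apply]; rfl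

lemma sesq_polarization (Q : E →ₗ⋆[ℂ] E →ₗ[ℂ] A) (x y : E) :
    (4 : ℂ) • Q x y = (Q (x + y) (x + y) - Q (x - y) (x - y))
      - Complex.I • (Q (x + Complex.I • y) (x + Complex.I • y)
        - Q (x - Complex.I • y) (x - Complex.I • y)) := by
  simp only [map_add, map_sub, LinearMap.add_apply, LinearMap.sub_apply, sesq_smul_left,
    map_smul, Complex.star_def, Complex.conj_I, smul_add, smul_sub, smul_smul,
    neg_smul, smul_neg, Complex.I_mul_I]
  module

/-- A form with self-adjoint diagonal is hermitian. -/
lemma sesq_hermitian (Q : E →ₗ⋆[ℂ] E →ₗ[ℂ] A) (h : ∀ x, IsSelfAdjoint (Q x x)) (x y : E) :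
    star (Q x y) = Q y x := by
  have h1 := sesq_polarization Q x y
  have h2 := sesq_polarization Q y x
  -- Exchanging x and y only permutes the four diagonal values in the polarization identity, up to
  -- unimodular scalars, which cancel on the diagonal.
  have e1 : Q (y - x) (y - x) = Q (x - y) (x - y) := by
    rw [← neg_sub x y]; simp only [map_neg, LinearMap.neg_apply, neg_neg]
  have e2 : Q (y + Complex.I • x) (y + Complex.I • x)
      = Q (x - Complex.I • y) (x - Complex.I • y) := by
    have : y + Complex.I • x = Complex.I • (x - Complex.I • y) := by
      rw [smul_sub, smul_smul, Complex.I_mul_I]; module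
    rw [this, sesq_smul_left, map_smul, smul_smul]
    simp
  have e3 : Q (y - Complex.I • x) (y - Complex.I • x)
      = Q (x + Complex.I • y) (x + Complex.I • y) := by
    have : y - Complex.I • x = (-Complex.I) • (x + Complex.I • y) := by
      rw [smul_add, smul_smul, neg_mul, Complex.I_mul_I]; module
    rw [this, sesq_smul_left, map_smul, smul_smul]
    simp
  have h3 := congrArg star h1
  simp only [star_smul, star_sub, (h _).star_eq] at h3
  rw [e1, e2, e3, add_comm y x] at h2
  have h4 : (4 : ℂ) • star (Q x y) = (4 : ℂ) • Q y x := by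
    rw [h2]
    have : star (4 : ℂ) = 4 := by simp
    rw [this] at h3
    rw [h3]
    simp only [Complex.star_def, Complex.conj_I]
    module
  exact smul_right_injective _ (by norm_num : (4 : ℂ) ≠ 0) h4

/-- A form which is bounded on the diagonal is bounded. -/
lemma sesq_bound {F : Type*} [NormedAddCommGroup F] [NormedSpace ℂ F] (Φ : E →ₗ[ℂ] F)
    (Q : E →ₗ⋆[ℂ] E →ₗ[ℂ] A) {c : ℝ} (hc : 0 ≤ c) (h : ∀ x, ‖Q x x‖ ≤ c * ‖Φ x‖ ^ 2) (x y : E) :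
    ‖Q x y‖ ≤ 4 * c * ‖Φ x‖ * ‖Φ y‖ := by
  have key : ∀ x y, ‖Q x y‖ ≤ c * (‖Φ x‖ + ‖Φ y‖) ^ 2 := by
    intro x y
    have h1 := congrArg norm (sesq_polarization Q x y)
    have hb : ∀ z, ‖z‖ ≤ ‖Φ y‖ → ∀ u, Φ u = Φ x + z → ‖Q u u‖ ≤ c * (‖Φ x‖ + ‖Φ y‖) ^ 2 := by
      intro z hz u hu
      refine (h u).trans ?_
      gcongr
      rw [hu]
      exact (norm_add_le _ _).trans (by gcongr)
    have b1 := hb (Φ y) le_rfl (x + y) (by simp)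
    have b2 := hb (-Φ y) (by simp) (x - y) (by simp [sub_eq_add_neg])
    have b3 := hb (Complex.I • Φ y) (by simp [norm_smul]) (x + Complex.I • y) (by simp)
    have b4 := hb (-(Complex.I • Φ y)) (by simp [norm_smul]) (x - Complex.I • y)
      (by simp [sub_eq_add_neg])
    have h2 : (4 : ℝ) * ‖Q x y‖ ≤ 4 * (c * (‖Φ x‖ + ‖Φ y‖) ^ 2) := by
      have e : ‖(4 : ℂ) • Q x y‖ = 4 * ‖Q x y‖ := by rw [norm_smul]; norm_num
      rw [← e, h1]
      refine (norm_sub_le _ _).trans ?_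
      rw [norm_smul, Complex.norm_I, one_mul]
      have := norm_sub_le (Q (x + y) (x + y)) (Q (x - y) (x - y))
      have := norm_sub_le (Q (x + Complex.I • y) (x + Complex.I • y))
        (Q (x - Complex.I • y) (x - Complex.I • y))
      linarith
    linarith
  -- Replacing (x, y) by (tx, t⁻¹y) leaves Q(x, y) unchanged. The choice t² = b/a balances ta and
  -- t⁻¹b, so (ta + t⁻¹b)² = 4ab; the ε keeps a and b positive and is then sent to 0.
  have key2 : ∀ ε : ℝ, 0 < ε → ‖Q x y‖ ≤ 4 * c * (‖Φ x‖ + ε) * (‖Φ y‖ + ε) := by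
    intro ε hε
    have ha : 0 < ‖Φ x‖ + ε := by positivity
    have hb : 0 < ‖Φ y‖ + ε := by positivity
    set a := ‖Φ x‖ + ε
    set b := ‖Φ y‖ + ε
    set t : ℝ := √(b / a)
    have ht : 0 < t := Real.sqrt_pos.2 (by positivity)
    have ht2 : t ^ 2 = b / a := Real.sq_sqrt (by positivity)
    have hk := key ((t : ℂ) • x) ((t⁻¹ : ℂ) • y)
    have e1 : Q ((t : ℂ) • x) ((t⁻¹ : ℂ) • y) = Q x y := by
      rw [sesq_smul_left, map_smul, smul_smul, Complex.star_def, Complex.conj_ofReal,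
        mul_inv_cancel₀ (by exact_mod_cast ht.ne'), one_smul]
    rw [e1, map_smul, map_smul, norm_smul, norm_smul, norm_inv, Complex.norm_real,
      Real.norm_of_nonneg ht.le] at hk
    refine hk.trans ?_
    have h5 : t * ‖Φ x‖ + t⁻¹ * ‖Φ y‖ ≤ t * a + t⁻¹ * b := by
      gcongr <;> simp only [a, b] <;> linarith
    have h6 : (t * a + t⁻¹ * b) ^ 2 = 4 * a * b := by
      have : b = t ^ 2 * a := by rw [ht2]; field_simp
      rw [this]; field_simp; ring
    calc c * (t * ‖Φ x‖ + t⁻¹ * ‖Φ y‖) ^ 2 ≤ c * (t * a + t⁻¹ * b) ^ 2 := by gcongr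
      _ = 4 * c * a * b := by rw [h6]; ring
  have hlim : Filter.Tendsto (fun ε : ℝ => 4 * c * (‖Φ x‖ + ε) * (‖Φ y‖ + ε))
      (nhdsWithin 0 (Set.Ioi 0)) (nhds (4 * c * ‖Φ x‖ * ‖Φ y‖)) := by
    have : Continuous fun ε : ℝ => 4 * c * (‖Φ x‖ + ε) * (‖Φ y‖ + ε) := by fun_prop
    have h7 := (this.tendsto 0).mono_left (nhdsWithin_le_nhds (s := Set.Ioi 0))
    simpa using h7
  exact ge_of_tendsto hlim (Filter.eventually_of_mem self_mem_nhdsWithin key2)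

end SesqBounds

/-! ### From bounded forms on a total subspace to adjointable operators. -/

section Representation

variable (A : Type*) [NonUnitalCStarAlgebra A] [PartialOrder A] [StarOrderedRing A]
  {M : Type*} [NormedAddCommGroup M] [NormedSpace ℂ M] [SMul Aᵐᵒᵖ M] [CStarModule Aᵐᵒᵖ M]

/-- Bounded `A`-linear maps on `N` are represented, with control of the norm, by vectors of `M`. -/
def HasRepresentation (N : Submodule ℂ M) : Prop :=
  ∀ (f : N →ₗ[ℂ] A) (C : ℝ), 0 ≤ C →
    (∀ (x : N) (a : A) (h : op a • (x : M) ∈ N), f ⟨_, h⟩ = f x * a) →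
    (∀ x, ‖f x‖ ≤ C * ‖x‖) → ∃ m : M, ‖m‖ ≤ C ∧ ∀ x : N, f x = ip A m x

variable {A}

/-- Bounded `A`-linear operators on a self-dual module have adjoints. -/
lemma IsSelfDual.exists_adjoint (hM : IsSelfDual A M) {D : M →L[ℂ] M} (hD : IsModuleMap A D) :
    ∃ D' : M →L[ℂ] M, IsAdjointPair A D D' := by
  have h : ∀ x : M, ∃ m : M, ∀ y, ip A x (D y) = ip A m y := fun x =>
    hM ((ipL A x).comp D) fun y a => by
      simp [hD y a, ip_act_right]
  choose E hE using h
  refine ⟨LinearMap.mkContinuous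
    { toFun := E
      map_add' := fun x x' => ext_ip_right (A := A) fun y => by
        rw [← hE, ip_add_left, ip_add_left, hE, hE]
      map_smul' := fun c x => ext_ip_right (A := A) fun y => by
        rw [← hE, ip_smul_left, RingHom.id_apply, ip_smul_left, hE] } ‖D‖ fun x => ?_,
    fun x y => hE x y⟩
  refine norm_le_of_ip_le (A := A) (by positivity) fun y => ?_
  simp only [LinearMap.coe_mk, AddHom.coe_mk]
  rw [← hE]
  calc ‖ip A x (D y)‖ ≤ ‖x‖ * ‖D y‖ := norm_ip_le A _ _
    _ ≤ ‖x‖ * (‖D‖ * ‖y‖) := by gcongr; exact D.le_opNorm y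
    _ = ‖D‖ * ‖x‖ * ‖y‖ := by ring

/-- Bounded hermitian `A`-valued forms on a total subspace of a self-dual module come from
adjointable operators, as soon as functionals on the subspace are represented. -/
theorem exists_operator_of_form (hM : IsSelfDual A M) {N : Submodule ℂ M} (hN : IsTotal A N)
    (hact : ∀ x ∈ N, ∀ a : A, op a • x ∈ N) (hR : HasRepresentation A N)
    (q : N →ₗ⋆[ℂ] N →ₗ[ℂ] A) {C : ℝ} (hC : 0 ≤ C)
    (hq : ∀ (x y : N) (a : A), q x ⟨op a • (y : M), hact y y.2 a⟩ = q x y * a)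
    (hherm : ∀ x y, star (q x y) = q y x) (hbd : ∀ x y, ‖q x y‖ ≤ C * ‖x‖ * ‖y‖) :
    ∃ D D' : M →L[ℂ] M, IsAdjointPair A D D' ∧ ∀ x y : N, q x y = ip A (x : M) (D y) := by
  have hT : ∀ x : N, ∃ m : M, ‖m‖ ≤ C * ‖x‖ ∧ ∀ y : N, q x y = ip A m y := fun x =>
    hR (q x) (C * ‖x‖) (by positivity) (fun y a h => hq x y a) (hbd x)
  choose T hTn hT using hT
  have ext' : ∀ {y z : M}, (∀ x : N, ip A y x = ip A z x) → y = z := fun {y z} h =>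
    hN.ext fun x hx => by rw [← star_ip, h ⟨x, hx⟩, star_ip]
  -- T is defined only on N, which need not be norm dense, so continuity may not extend it.
  -- Representing x ↦ ⟨y|Tx⟩ for every y in M gives an operator D on all of M; by self-duality D has
  -- an adjoint, and that adjoint extends T.
  have hD : ∀ y : M, ∃ m : M, ‖m‖ ≤ C * ‖y‖ ∧ ∀ x : N, ip A y (T x) = ip A m x := by
    intro y
    let f : N →ₗ[ℂ] A :=
      { toFun := fun x => ip A y (T x)
        map_add' := fun x x' => by
          have : T (x + x') = T x + T x' := ext' fun z => by
            rw [← hT, ip_add_left, map_add, LinearMap.add_apply, hT, hT]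
          rw [this, ip_add_right]
        map_smul' := fun c x => by
          have : T (c • x) = c • T x := ext' fun z => by
            rw [← hT, ip_smul_left, LinearMap.map_smulₛₗ, LinearMap.smul_apply, hT]; rfl
          rw [this, ip_smul_right]; rfl }
    refine hR f (C * ‖y‖) (by positivity) (fun x a h => ?_) (fun x => ?_)
    · have : T ⟨op a • (x : M), h⟩ = op a • T x := ext' fun z => by
        rw [← hT, ip_act_left, ← hT, ← hherm, hq, star_mul, hherm]
      change ip A y (T _) = ip A y (T x) * a
      rw [this, ip_act_right]
    · change ‖ip A y (T x)‖ ≤ _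
      calc ‖ip A y (T x)‖ ≤ ‖y‖ * ‖T x‖ := norm_ip_le A _ _
        _ ≤ ‖y‖ * (C * ‖x‖) := by gcongr; exact hTn x
        _ = C * ‖y‖ * ‖x‖ := by ring
  choose D hDn hD using hD
  let D₁ : M →L[ℂ] M := LinearMap.mkContinuous
    { toFun := D
      map_add' := fun y y' => ext' fun x => by
        rw [← hD, ip_add_left, ip_add_left, hD, hD]
      map_smul' := fun c y => ext' fun x => by
        rw [← hD, ip_smul_left, RingHom.id_apply, ip_smul_left, hD] } C hDn
  have hD₁ : ∀ y, D₁ y = D y := fun _ => rfl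
  obtain ⟨D', hD'⟩ := hM.exists_adjoint (D := D₁) fun y a => ext' fun x => by
    rw [hD₁, hD₁, ← hD, ip_act_left, ip_act_left, hD]
  refine ⟨D', D₁, hD'.symm, fun x y => ?_⟩
  rw [hD'.symm, hD₁, ← hD, ← star_ip, ← hT, hherm]

end Representation

/-! ### The form of a map on formal combinations of pairs (b, v). -/

section FormOfMap

variable {A B V : Type*} [NonUnitalCStarAlgebra A] [CStarAlgebra B] [AddCommGroup V] [Module ℂ V]
  [SMul Aᵐᵒᵖ V]

/-- The form `∑ S_{b_j⋆ b_k}(v_j, v_k)` on formal linear combinations of pairs `(b, v)`. -/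
def freeForm (R : B →ₗ[ℂ] SesqForm A V) :
    ((B × V) →₀ ℂ) →ₗ⋆[ℂ] ((B × V) →₀ ℂ) →ₗ[ℂ] A :=
  LinearMap.mk₂'ₛₗ (starRingEnd ℂ) (RingHom.id ℂ)
    (fun x y => x.sum fun p c => star c • Finsupp.linearCombination ℂ
      (fun r : B × V => (R (star p.1 * r.1)).1 p.2 r.2) y)
    (fun x x' y => Finsupp.sum_add_index' (by simp) (by simp [add_smul]))
    (fun c x y => by
      rw [Finsupp.sum_smul_index (by simp), Finsupp.sum, Finsupp.sum, Finset.smul_sum]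
      simp [mul_smul])
    (fun x y y' => by simp [Finsupp.sum_add])
    (fun c x y => by
      simp only [map_smul, Finsupp.sum, Finset.smul_sum, RingHom.id_apply]
      exact Finset.sum_congr rfl fun _ _ => smul_comm _ _ _)

lemma freeForm_apply (R : B →ₗ[ℂ] SesqForm A V) (x y : (B × V) →₀ ℂ) :
    freeForm R x y = ∑ p ∈ x.support, ∑ r ∈ y.support,
      (R (star p.1 * r.1)).1 (x p • p.2) (y r • r.2) := by
  simp only [freeForm, LinearMap.mk₂'ₛₗ_apply, Finsupp.sum, Finsupp.linearCombination_apply,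
    Finset.smul_sum]
  refine Finset.sum_congr rfl fun p _ => Finset.sum_congr rfl fun r _ => ?_
  rw [sesq_smul_left, map_smul]

lemma freeForm_single (R : B →ₗ[ℂ] SesqForm A V) (b c : B) (v w : V) :
    freeForm R (Finsupp.single (b, v) 1) (Finsupp.single (c, w) 1) = (R (star b * c)).1 v w := by
  simp [freeForm]

lemma freeForm_add (R R' : B →ₗ[ℂ] SesqForm A V) (x y : (B × V) →₀ ℂ) :
    freeForm (R + R') x y = freeForm R x y + freeForm R' x y := by
  simp only [freeForm_apply, ← Finset.sum_add_distrib]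
  rfl

lemma freeForm_smul (t : ℝ) (R : B →ₗ[ℂ] SesqForm A V) (x y : (B × V) →₀ ℂ) :
    freeForm (t • R) x y = t • freeForm R x y := by
  rw [freeForm_apply, freeForm_apply, Finset.smul_sum]
  refine Finset.sum_congr rfl fun p _ => ?_
  rw [Finset.smul_sum]
  rfl

variable [PartialOrder A] [StarOrderedRing A]

lemma IsCP.finset {R : B →ₗ[ℂ] SesqForm A V} (hR : IsCP R) {ι : Type*} (s : Finset ι)
    (b : ι → B) (v : ι → V) :
    0 ≤ ∑ i ∈ s, ∑ j ∈ s, (R (star (b i) * b j)).1 (v i) (v j) := by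
  have h := hR s.card (fun i => b (s.equivFin.symm i)) fun i => v (s.equivFin.symm i)
  convert h using 1
  rw [← Finset.sum_coe_sort, ← s.equivFin.symm.sum_comp]
  refine Finset.sum_congr rfl fun i _ => ?_
  rw [← Finset.sum_coe_sort, ← s.equivFin.symm.sum_comp]

lemma IsCP.freeForm_nonneg {R : B →ₗ[ℂ] SesqForm A V} (hR : IsCP R) (x : (B × V) →₀ ℂ) :
    0 ≤ freeForm R x x := by
  rw [freeForm_apply]
  exact hR.finset x.support (fun p => p.1) fun p => x p • p.2

/-- A completely positive map is positive on the diagonal. -/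
lemma IsCP.nonneg [PartialOrder B] [StarOrderedRing B] {R : B →ₗ[ℂ] SesqForm A V} (hR : IsCP R)
    {b : B} (hb : 0 ≤ b) (v : V) : 0 ≤ (R b).1 v v := by
  obtain ⟨c, rfl⟩ := CStarAlgebra.nonneg_iff_eq_star_mul_self.1 hb
  simpa using hR 1 (fun _ => c) fun _ => v

end FormOfMap

/-! ### The Radon–Nikodym argument: the commutant condition implies extremality. -/

namespace CovariantDilation

variable {A B V G : Type*} [NonUnitalCStarAlgebra A] [PartialOrder A] [StarOrderedRing A]
  [CStarAlgebra B] [AddCommGroup V] [Module ℂ V] [SMul Aᵐᵒᵖ V] [Group G]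
  {β : G →* (B ≃⋆ₐ[ℂ] B)} {U : G →* (V ≃ₗ[ℂ] V)} {S : B →ₗ[ℂ] SesqForm A V}
  {M : Type*} [NormedAddCommGroup M] [NormedSpace ℂ M] [SMul Aᵐᵒᵖ M] [CStarModule Aᵐᵒᵖ M]

/-- The vector `π(b)Jv` as an element of the span. -/
def gen (d : CovariantDilation β U S M) (b : B) (v : V) : d.range :=
  ⟨d.π b (d.J v), d.mem_range b v⟩

lemma coe_gen (d : CovariantDilation β U S M) (b : B) (v : V) :
    (d.gen b v : M) = d.π b (d.J v) := rfl

/-- Identities on the span reduce to generators. The target W is arbitrary, so the lemma applies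
twice to a sesquilinear form: once with values in linear maps, once with values in W. -/
lemma range_ext (d : CovariantDilation β U S M) {σ : ℂ →+* ℂ} {W : Type*} [AddCommGroup W]
    [Module ℂ W] {F F' : d.range →ₛₗ[σ] W} (h : ∀ b v, F (d.gen b v) = F' (d.gen b v)) :
    F = F' := by
  ext ⟨x, hx⟩
  induction hx using Submodule.span_induction with
  | zero => exact (map_zero F).trans (map_zero F').symm
  | add x x' hx hx' h h' =>
    have := congrArg₂ (· + ·) h h'
    simpa only [← map_add] using! this
  | smul c x hx h =>
    have := congrArg (σ c • ·) h
    simpa only [← LinearMap.map_smulₛₗ] using! this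
  | mem x hx =>
    obtain ⟨b, v, rfl⟩ := hx
    exact h b v

lemma range_ext₂ (d : CovariantDilation β U S M) {W : Type*} [AddCommGroup W]
    [Module ℂ W] {F F' : d.range →ₗ⋆[ℂ] d.range →ₗ[ℂ] W}
    (h : ∀ b v c w, F (d.gen b v) (d.gen c w) = F' (d.gen b v) (d.gen c w)) (x y : d.range) :
    F x y = F' x y := by
  have : F = F' := d.range_ext fun b v => d.range_ext fun c w => h b v c w
  rw [this]

/-- The linear map sending the formal pair `(b, v)` to `π(b)Jv`. -/
def free (d : CovariantDilation β U S M) : ((B × V) →₀ ℂ) →ₗ[ℂ] d.range :=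
  Finsupp.linearCombination ℂ fun p => d.gen p.1 p.2

lemma free_single (d : CovariantDilation β U S M) (b : B) (v : V) :
    d.free (Finsupp.single (b, v) 1) = d.gen b v := by
  simp [free]

lemma free_range (d : CovariantDilation β U S M) : LinearMap.range d.free = ⊤ := by
  rw [eq_top_iff]
  rintro ⟨x, hx⟩ -
  induction hx using Submodule.span_induction with
  | zero => exact zero_mem _
  | add x x' _ _ h h' => exact add_mem h h'
  | smul c x _ h => exact Submodule.smul_mem _ c h
  | mem x hx =>
    obtain ⟨b, v, rfl⟩ := hx
    exact ⟨_, d.free_single b v⟩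

/-- The formal form of S is the pullback of the inner product along `free`. A form dominated by it
therefore vanishes on the kernel of `free`. -/
lemma freeForm_eq_ip (d : CovariantDilation β U S M) (x y : (B × V) →₀ ℂ) :
    freeForm S x y = ip A (d.free x : M) (d.free y) := by
  simp only [free, Finsupp.linearCombination_apply, Finsupp.sum, Submodule.coe_sum,
    Submodule.coe_smul, ip_sum_left, freeForm_apply]
  simp only [ip_sum_right]
  refine Finset.sum_congr rfl fun p _ => Finset.sum_congr rfl fun r _ => ?_
  rw [d.dilates, map_smul, map_smul, map_smul, ip_smul_left, ip_smul_left, ip_smul_right,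
    ip_smul_right, map_mul, mul_apply_eq_comp, d.π_star, star_star]
  rfl

/-- A completely positive map dominated by a multiple of `S` induces a bounded hermitian form on
the span of the vectors `π(b)Jv`. -/
lemma exists_form (d : CovariantDilation β U S M) {R : B →ₗ[ℂ] SesqForm A V} (hR : IsCP R)
    {c : ℝ} (hc : 0 ≤ c) {R' : B →ₗ[ℂ] SesqForm A V} (hR' : IsCP R') (hRS : R + R' = c • S) :
    ∃ q : d.range →ₗ⋆[ℂ] d.range →ₗ[ℂ] A,
      (∀ b v b' v', q (d.gen b v) (d.gen b' v') = (R (star b * b')).1 v v') ∧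
      (∀ x y, star (q x y) = q y x) ∧ ∀ x y, ‖q x y‖ ≤ 4 * c * ‖x‖ * ‖y‖ := by
  have hbd := sesq_bound d.free (freeForm R) hc fun x => by
    have h1 : freeForm R x x ≤ c • ip A (d.free x : M) (d.free x) := by
      rw [← d.freeForm_eq_ip, ← freeForm_smul, ← hRS, freeForm_add]
      exact le_add_of_nonneg_right (hR'.freeForm_nonneg x)
    have h2 := CStarAlgebra.norm_le_norm_of_nonneg_of_le (hR.freeForm_nonneg x) h1
    rwa [norm_smul, Real.norm_of_nonneg hc, ← norm_sq_eq] at h2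
  have hherm := sesq_hermitian (freeForm R) fun x => .of_nonneg (hR.freeForm_nonneg x)
  -- The form descends to the span through a linear section σ of `free`; by the bound, its values do
  -- not depend on the lifts.
  obtain ⟨σ, hσ⟩ := d.free.exists_rightInverse_of_surjective d.free_range
  have hσ' : ∀ x, d.free (σ x) = x := fun x => DFunLike.congr_fun hσ x
  have hzero : ∀ x y, d.free x = 0 → freeForm R x y = 0 := fun x y hx => by
    have := hbd x y
    rw [hx, norm_zero, mul_zero, zero_mul] at this
    exact norm_le_zero_iff.1 this
  have hcongr : ∀ x x' y, d.free x = d.free x' → freeForm R x y = freeForm R x' y :=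
    fun x x' y h => by
      have := hzero (x - x') y (by rw [map_sub, h, sub_self])
      rwa [map_sub, LinearMap.sub_apply, sub_eq_zero] at this
  refine ⟨LinearMap.mk₂'ₛₗ (starRingEnd ℂ) (RingHom.id ℂ) (fun x y => freeForm R (σ x) (σ y))
    (fun x x' y => by simp) (fun e x y => by simp) (fun x y y' => by simp) (fun e x y => by simp),
    fun b v b' v' => ?_, fun x y => ?_, fun x y => ?_⟩
  · simp only [LinearMap.mk₂'ₛₗ_apply]
    rw [← freeForm_single, hcongr _ (Finsupp.single (b, v) 1) _ (by rw [hσ', free_single]),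
      ← hherm, hcongr _ (Finsupp.single (b', v') 1) _ (by rw [hσ', free_single]), hherm]
  · exact hherm _ _
  · have := hbd (σ x) (σ y)
    rwa [hσ', hσ'] at this

lemma act_mem_range (d : CovariantDilation β U S M) (x : M) (hx : x ∈ d.range) (a : A) :
    op a • x ∈ d.range := by
  induction hx using Submodule.span_induction with
  | zero => rw [act_zero]; exact zero_mem _
  | add x x' _ _ h h' => rw [act_add]; exact add_mem h h'
  | smul c x _ h => rw [act_smul]; exact Submodule.smul_mem _ c h
  | mem x hx =>
    obtain ⟨b, v, rfl⟩ := hx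
    rw [← d.π_module, ← d.J_module]
    exact d.mem_range b _

lemma π_mem_range (d : CovariantDilation β U S M) (b : B) (x : M) (hx : x ∈ d.range) :
    d.π b x ∈ d.range := by
  induction hx using Submodule.span_induction with
  | zero => rw [map_zero]; exact zero_mem _
  | add x x' _ _ h h' => rw [map_add]; exact add_mem h h'
  | smul c x _ h => rw [map_smul]; exact Submodule.smul_mem _ c h
  | mem x hx =>
    obtain ⟨c, v, rfl⟩ := hx
    rw [← mul_apply_eq_comp, ← map_mul]
    exact d.mem_range _ v

lemma Ut_gen (d : CovariantDilation β U S M) (g : G) (b : B) (v : V) :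
    d.Ut g (d.π b (d.J v)) = d.π (β g b) (d.J (U g v)) := by
  rw [d.J_covariant]
  exact DFunLike.congr_fun (d.π_covariant g b) (d.J v)

lemma Ut_mem_range (d : CovariantDilation β U S M) (g : G) (x : M) (hx : x ∈ d.range) :
    d.Ut g x ∈ d.range := by
  induction hx using Submodule.span_induction with
  | zero => rw [map_zero]; exact zero_mem _
  | add x x' _ _ h h' => rw [map_add]; exact add_mem h h'
  | smul c x _ h => rw [map_smul]; exact Submodule.smul_mem _ c h
  | mem x hx =>
    obtain ⟨c, v, rfl⟩ := hx
    rw [d.Ut_gen]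
    exact d.mem_range _ _

/-- The right action of `a` on the span. -/
def actRange (d : CovariantDilation β U S M) (a : A) : d.range →ₗ[ℂ] d.range where
  toFun x := ⟨op a • (x : M), d.act_mem_range x x.2 a⟩
  map_add' x y := Subtype.ext (act_add A (x : M) y a)
  map_smul' c x := Subtype.ext (act_smul A c (x : M) a)

/-- The operator `π(b)` on the span. -/
def πRange (d : CovariantDilation β U S M) (b : B) : d.range →ₗ[ℂ] d.range :=
  (d.π b).toLinearMap.restrict (d.π_mem_range b)

/-- The operator `Ũ(g)` on the span. -/
def UtRange (d : CovariantDilation β U S M) (g : G) : d.range →ₗ[ℂ] d.range :=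
  (d.Ut g).toLinearMap.restrict (d.Ut_mem_range g)

lemma actRange_gen (d : CovariantDilation β U S M) (a : A) (b : B) (v : V) :
    d.actRange a (d.gen b v) = d.gen b (op a • v) :=
  Subtype.ext (by rw [coe_gen, d.J_module, d.π_module]; rfl)

lemma πRange_gen (d : CovariantDilation β U S M) (b c : B) (v : V) :
    d.πRange b (d.gen c v) = d.gen (b * c) v :=
  Subtype.ext (by rw [coe_gen, map_mul, mul_apply_eq_comp]; rfl)

lemma UtRange_gen (d : CovariantDilation β U S M) (g : G) (c : B) (v : V) :
    d.UtRange g (d.gen c v) = d.gen (β g c) (U g v) :=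
  Subtype.ext (by rw [coe_gen, ← d.Ut_gen]; rfl)

/-- Under the extremality condition, `S` is the only element of `CP β U s₁` which is dominated by a
multiple of `S`. -/
lemma eq_of_dominated (d : CovariantDilation β U S M) {s₁ : SesqForm A V} (hS : S ∈ CP β U s₁)
    (hM : IsSelfDual A M) (hN : IsTotal A d.range) (hrep : HasRepresentation A d.range)
    (hd : d.ExtremalityCondition) {R : B →ₗ[ℂ] SesqForm A V} (hR : R ∈ CP β U s₁) {c : ℝ}
    (hc : 0 ≤ c) {R' : B →ₗ[ℂ] SesqForm A V} (hR' : IsCP R') (hRS : R + R' = c • S) : R = S := by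
  obtain ⟨q, hq, hherm, hbd⟩ := d.exists_form hR.1 hc hR' hRS
  obtain ⟨D, D', hDD', hD⟩ := exists_operator_of_form hM hN d.act_mem_range hrep q
    (C := 4 * c) (by positivity)
    (fun x y a => by
      refine d.range_ext₂ (F := q.compl₂ (d.actRange a))
        (F' := LinearMap.mk₂'ₛₗ (starRingEnd ℂ) (RingHom.id ℂ) (fun x y => q x y * a)
          (by simp [add_mul]) (by simp [smul_mul_assoc]) (by simp [add_mul])
          (by simp [smul_mul_assoc])) (fun b v b' v' => ?_) x y
      simp only [LinearMap.compl₂_apply, LinearMap.mk₂'ₛₗ_apply]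
      rw [actRange_gen, hq, hq, (R _).2.1]) hherm hbd
  -- On generators both sides are R at c*bc'. Together with the invariance of q under Ũ, from
  -- covariance of R, this makes D commute with π and Ũ.
  have hqπ : ∀ b x y, q x (d.πRange b y) = q (d.πRange (star b) x) y := fun b =>
    d.range_ext₂ (F := q.compl₂ (d.πRange b)) (F' := q.comp (d.πRange (star b)))
      fun c v c' v' => by
        rw [LinearMap.compl₂_apply, LinearMap.comp_apply, πRange_gen, πRange_gen, hq, hq, star_mul,
          star_star, mul_assoc]
  have hqU : ∀ g x y, q (d.UtRange g x) (d.UtRange g y) = q x y := fun g =>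
    d.range_ext₂ (F := (q.compl₂ (d.UtRange g)).comp (d.UtRange g)) (F' := q)
      fun c v c' v' => by
        rw [LinearMap.comp_apply, LinearMap.compl₂_apply, UtRange_gen, UtRange_gen, hq, hq,
          ← map_star, ← map_mul, hR.2.1, ← LinearEquiv.mul_apply, ← LinearEquiv.mul_apply,
          ← map_mul, inv_mul_cancel, map_one]
        rfl
  have hcomm : ∀ T T' : M →L[ℂ] M, IsAdjointPair A T T' →
      (∀ x : d.range, ∀ y : d.range, ip A (x : M) (D (T y)) = ip A (x : M) (T (D y))) →
      Commute D T := by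
    intro T T' hT h
    -- The commutator has an adjoint and vanishing matrix elements on the total span, hence is zero.
    have h0 := hN.eq_zero ((hDD'.mul hT).sub (hT.mul hDD')) fun y hy => by
      refine hN.ext fun x hx => ?_
      rw [sub_apply, ip_sub_right, ip_zero_right, sub_eq_zero]
      exact h ⟨x, hx⟩ ⟨y, hy⟩
    exact sub_eq_zero.1 h0
  have hDπ : ∀ b, Commute D (d.π b) := fun b => hcomm _ _ (d.π_star b) fun x y => by
    rw [d.π_star b]
    exact (hD x (d.πRange b y)).symm.trans ((hqπ b x y).trans (hD _ y))
  have hDU : ∀ g, Commute D (d.Ut g) := fun g => hcomm _ _ (d.Ut_adjoint g) fun x y => by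
    rw [d.Ut_adjoint g]
    refine (hD x (d.UtRange g y)).symm.trans (Eq.trans ?_ (hD (d.UtRange g⁻¹ x) y))
    rw [← hqU g (d.UtRange g⁻¹ x) y]
    congr 2
    exact Subtype.ext (d.Ut_mul_inv g x).symm
  have hgen1 : ∀ v, (d.gen 1 v : M) = d.J v := fun v => by
    rw [coe_gen, map_one, one_apply_eq_self]
  have hRD : ∀ b v w, (R b).1 v w = ip A (d.J v) (D (d.π b (d.J w))) := fun b v w => by
    have := hD (d.gen 1 v) (d.gen b w)
    rwa [hq, star_one, one_mul, hgen1, coe_gen] at this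
  -- R and S both equal s₁ at 1, so ⟨Jv|DJv⟩ = ⟨Jv|Jv⟩ and condition (∗) applies to D − 1.
  have hD1 : D - 1 = 0 := by
    refine hd _ (hDD'.sub isAdjointPair_one).isAdjointable
      (fun b => (hDπ b).sub_left (Commute.one_left _))
      (fun g => (hDU g).sub_left (Commute.one_left _)) fun v => ?_
    have h1 := hRD 1 v v
    have h2 := d.dilates 1 v v
    rw [hR.2.2, map_one, one_apply_eq_self] at h1
    rw [hS.2.2, map_one, one_apply_eq_self] at h2
    rw [sub_apply, ip_sub_right, ← h1, one_apply_eq_self, ← h2, sub_self]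
  ext b v w
  rw [hRD, d.dilates, sub_eq_zero.1 hD1, one_apply_eq_self]

/-- The extremality condition implies extremality. -/
theorem extreme_of_extremalityCondition (d : CovariantDilation β U S M) {s₁ : SesqForm A V}
    (hS : S ∈ CP β U s₁) (hM : IsSelfDual A M) (hN : IsTotal A d.range)
    (hrep : HasRepresentation A d.range) (hd : d.ExtremalityCondition) :
    S ∈ (CP β U s₁).extremePoints ℝ := by
  have aux : ∀ {R R' : B →ₗ[ℂ] SesqForm A V} {t t' : ℝ}, R ∈ CP β U s₁ → R' ∈ CP β U s₁ → 0 < t →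
      0 < t' → t • R + t' • R' = S → R = S := by
    intro R R' t t' hR hR' ht ht' h
    -- Dividing tR + t'R' = S by t exhibits R as dominated by t⁻¹S, with completely positive
    -- difference t⁻¹t'R'.
    refine d.eq_of_dominated hS hM hN hrep hd hR (c := t⁻¹) (by positivity)
      (R' := (t⁻¹ * t') • R') ?_ ?_
    swap
    · ext b v w
      rw [← h]
      change (R b).1 v w + (t⁻¹ * t') • (R' b).1 v w
        = t⁻¹ • (t • (R b).1 v w + t' • (R' b).1 v w)
      rw [smul_add, smul_smul, inv_mul_cancel₀ ht.ne', one_smul, smul_smul]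
    intro n b v
    have h1 := smul_nonneg (by positivity : (0 : ℝ) ≤ t⁻¹ * t') (hR'.1 n b v)
    convert h1 using 1
    simp only [Finset.smul_sum]
    rfl
  rw [mem_extremePoints]
  refine ⟨hS, ?_⟩
  rintro R hR R' hR' ⟨t, t', ht, ht', -, h⟩
  exact ⟨aux hR hR' ht ht' h, aux hR' hR ht' ht (by rw [add_comm]; exact h)⟩

end CovariantDilation

/-! ### Representing functionals on a norm dense submodule. -/

section DenseRepresentation

variable {A : Type*} [NonUnitalCStarAlgebra A] [PartialOrder A] [StarOrderedRing A]
  {M : Type*} [NormedAddCommGroup M] [NormedSpace ℂ M] [SMul Aᵐᵒᵖ M] [CStarModule Aᵐᵒᵖ M]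

/-- Functionals on a norm dense submodule of a self-dual module are represented. -/
lemma hasRepresentation_of_dense (hM : IsSelfDual A M) {N : Submodule ℂ M}
    (hact : ∀ x ∈ N, ∀ a : A, op a • x ∈ N) (hN : Dense (N : Set M)) : HasRepresentation A N := by
  intro f C hC hf hb
  let F : M →L[ℂ] A := (f.mkContinuous C hb).extend N.subtypeL
  have hF : ∀ x : N, F x = f x := fun x =>
    ContinuousLinearMap.extend_eq (f.mkContinuous C hb) (e := N.subtypeL)
      (by simpa [DenseRange] using hN) (isUniformInducing_val (N : Set M)) x
  have hFa : ∀ (x : M) (a : A), F (op a • x) = F x * a := by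
    intro x a
    have h : (fun x => F (op a • x)) = fun x => F x * a := by
      refine Continuous.ext_on hN (F.continuous.comp (continuous_act A a))
        (F.continuous.mul continuous_const) fun x hx => ?_
      have := hf ⟨x, hx⟩ a (hact x hx a)
      rwa [← hF, ← hF] at this
    exact congrFun h x
  have hFb : ∀ x, ‖F x‖ ≤ C * ‖x‖ := by
    intro x
    have hcl : IsClosed {x : M | ‖F x‖ ≤ C * ‖x‖} :=
      isClosed_le (by fun_prop) (by fun_prop)
    have hsub : (N : Set M) ⊆ {x : M | ‖F x‖ ≤ C * ‖x‖} := fun x hx => by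
      have := hb ⟨x, hx⟩
      rwa [← hF] at this
    exact hcl.closure_subset_iff.2 hsub (hN x)
  obtain ⟨m, hm⟩ := hM F hFa
  exact ⟨m, norm_le_of_ip_le (A := A) hC fun y => by rw [← hm]; exact hFb y,
    fun x => by rw [← hm, hF]⟩

end DenseRepresentation

/-! ### Resolvents and approximate representation of functionals. -/

section Resolvent

variable {A : Type*} [NonUnitalCStarAlgebra A] [PartialOrder A] [StarOrderedRing A]
  {M : Type*} [NormedAddCommGroup M] [NormedSpace ℂ M] [SMul Aᵐᵒᵖ M] [CStarModule Aᵐᵒᵖ M]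

/-- The norm of a symmetric operator is bounded by its numerical radius. -/
lemma norm_le_of_numerical {R : M →L[ℂ] M} (hR : IsAdjointPair A R R) {r : ℝ} (hr : 0 < r)
    (h : ∀ x, ip A x (R x) ≤ r • ip A x x) (h' : ∀ x, -(r • ip A x x) ≤ ip A x (R x)) :
    ‖R‖ ≤ r := by
  refine R.opNorm_le_bound hr.le fun x => norm_le_of_ip_self_le (A := A) hr.le ?_
  -- Subtracting the numerical bounds at x + y and x − y gives 4r⁻¹⟨Rx|Rx⟩ ≤ 2r⟨x|x⟩ + 2r⁻¹⟨Rx|Rx⟩,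
  -- that is ⟨Rx|Rx⟩ ≤ r²⟨x|x⟩, an inequality in A.
  set y : M := ((r⁻¹ : ℝ) : ℂ) • R x with hy
  have h1 := add_le_add (h (x + y)) (neg_le_neg (h' (x - y)))
  have hxy : ip A x (R y) = (r⁻¹ : ℝ) • ip A (R x) (R x) := by
    rw [hR, hy, ip_smul_right, Complex.coe_smul]
  have hyx : ip A y (R x) = (r⁻¹ : ℝ) • ip A (R x) (R x) := by
    rw [hy, ip_smul_left, Complex.star_def, Complex.conj_ofReal, Complex.coe_smul]
  have hyy : ip A y y = (r⁻¹ * r⁻¹ : ℝ) • ip A (R x) (R x) := by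
    rw [hy, ip_smul_left, ip_smul_right, Complex.star_def, Complex.conj_ofReal, Complex.coe_smul,
      Complex.coe_smul, smul_smul]
  have e1 : ip A (x + y) (R (x + y)) + -ip A (x - y) (R (x - y))
      = (4 * r⁻¹) • ip A (R x) (R x) := by
    simp only [map_add, map_sub, ip_add_left, ip_add_right, ip_sub_left, ip_sub_right, hxy, hyx]
    module
  have e2 : r • ip A (x + y) (x + y) + - -(r • ip A (x - y) (x - y))
      = (2 * r) • ip A x x + (2 * r⁻¹) • ip A (R x) (R x) := by
    simp only [ip_add_left, ip_add_right, ip_sub_left, ip_sub_right, hyy]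
    have : (2 * r⁻¹) = 2 * r * (r⁻¹ * r⁻¹) := by field_simp
    rw [this]
    module
  rw [e1, e2] at h1
  have h2 : (2 * r⁻¹) • ip A (R x) (R x) ≤ (2 * r) • ip A x x := by
    rw [← sub_le_iff_le_add] at h1
    refine le_trans (le_of_eq ?_) h1
    module
  have h3 := smul_le_smul_of_nonneg_left h2 (by positivity : (0 : ℝ) ≤ r / 2)
  rw [smul_smul, smul_smul] at h3
  have e3 : r / 2 * (2 * r⁻¹) = 1 := by field_simp
  have e4 : r / 2 * (2 * r) = r ^ 2 := by ring
  rwa [e3, e4, one_smul] at h3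

/-- `t + T` is invertible for a positive symmetric operator `T` and `t > 0`. -/
lemma exists_resolvent [CompleteSpace M] {T : M →L[ℂ] M} (hT : IsAdjointPair A T T)
    (hpos : ∀ x, 0 ≤ ip A x (T x)) {t : ℝ} (ht : 0 < t) :
    ∃ R : M →L[ℂ] M, IsAdjointPair A R R ∧ ∀ x, (t : ℂ) • R x + T (R x) = x := by
  -- For K = t + T, the form of Y = 1 − K/c lies between 0 and 1 − t/c times ⟨x|x⟩. Hence ‖Y‖ < 1,
  -- and K = c(1 − Y) is invertible by the Neumann series.
  set c : ℝ := 1 + t + ‖T‖ with hc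
  have hc0 : 0 < c := by positivity
  have hnT := norm_nonneg T
  set K : M →L[ℂ] M := (t : ℂ) • 1 + T with hK
  have hKs : IsAdjointPair A K K := by
    have := (isAdjointPair_one (A := A) (M := M)).smul (t : ℂ)
    rw [Complex.star_def, Complex.conj_ofReal] at this
    exact this.add hT
  set Y : M →L[ℂ] M := 1 - ((c⁻¹ : ℝ) : ℂ) • K with hY
  have hYs : IsAdjointPair A Y Y := by
    have := hKs.smul ((c⁻¹ : ℝ) : ℂ)
    rw [Complex.star_def, Complex.conj_ofReal] at this
    exact isAdjointPair_one.sub this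
  have hYx : ∀ x, ip A x (Y x) = (1 - c⁻¹ * t) • ip A x x - c⁻¹ • ip A x (T x) := by
    intro x
    simp only [hY, hK, sub_apply, smul_apply, add_apply, one_apply_eq_self, ip_sub_right,
      ip_smul_right, ip_add_right]
    simp only [Complex.coe_smul]
    module
  have hr : 0 < 1 - c⁻¹ * t := by
    have : c⁻¹ * t < 1 := by rw [inv_mul_lt_iff₀ hc0]; linarith
    linarith
  have hYn : ‖Y‖ ≤ 1 - c⁻¹ * t := by
    refine norm_le_of_numerical hYs hr (fun x => ?_) fun x => ?_
    · rw [hYx]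
      exact sub_le_self _ (smul_nonneg (by positivity) (hpos x))
    · refine le_trans (neg_nonpos.2 (smul_nonneg hr.le (ip_self_nonneg A x))) ?_
      rw [hYx, sub_nonneg]
      have h1 := smul_le_smul_of_nonneg_left
        (ip_apply_le hT x (c := 1 + ‖T‖) (by positivity) (by linarith))
        (by positivity : (0 : ℝ) ≤ c⁻¹)
      refine h1.trans (le_of_eq ?_)
      rw [smul_smul]
      congr 1
      field_simp
      rw [hc]; ring
  obtain ⟨u, hu⟩ := isUnit_one_sub_of_norm_lt_one (hYn.trans_lt (by
    have : 0 < c⁻¹ * t := by positivity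
    linarith))
  have hKu : K = (c : ℂ) • (u : M →L[ℂ] M) := by
    rw [hu, hY, sub_sub_cancel, smul_smul, ← Complex.ofReal_mul, mul_inv_cancel₀ hc0.ne',
      Complex.ofReal_one, one_smul]
  set R : M →L[ℂ] M := ((c⁻¹ : ℝ) : ℂ) • ((u⁻¹ : (M →L[ℂ] M)ˣ) : M →L[ℂ] M) with hRdef
  have hKR : K * R = 1 := by
    rw [hKu, hRdef, smul_mul_smul_comm, Units.mul_inv, ← Complex.ofReal_mul,
      mul_inv_cancel₀ hc0.ne', Complex.ofReal_one, one_smul]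
  have hKRx : ∀ x, K (R x) = x := fun x => DFunLike.congr_fun hKR x
  refine ⟨R, fun x y => ?_, fun x => ?_⟩
  · conv_lhs => rw [← hKRx x]
    rw [← hKs, hKRx]
  · simpa [hK] using hKRx x

variable (A) in
/-- The operator `x⟨x|·⟩`. -/
def rankOne (x : M) : M →L[ℂ] M :=
  LinearMap.mkContinuous
    { toFun := fun y => op (ip A x y) • x
      map_add' := fun y y' => by rw [ip_add_right, add_act]
      map_smul' := fun c y => by rw [ip_smul_right, smul_act]; rfl } (‖x‖ * ‖x‖) fun y => by
    refine (norm_act_le A x _).trans ?_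
    rw [mul_assoc]
    gcongr
    exact norm_ip_le A x y

lemma rankOne_apply (x y : M) : rankOne A x y = op (ip A x y) • x := rfl

lemma rankOne_symm (x : M) : IsAdjointPair A (rankOne A x) (rankOne A x) := fun y z => by
  rw [rankOne_apply, rankOne_apply, ip_act_right, ip_act_left, star_ip]

lemma ip_rankOne (x y : M) : ip A y (rankOne A x y) = star (ip A x y) * ip A x y := by
  rw [rankOne_apply, ip_act_right, star_ip]

/-- Bounded functionals on a submodule are approximated on finite sets by vectors, with control
of the norm. -/
lemma exists_approx_representation [CompleteSpace M] {N : Submodule ℂ M}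
    (hact : ∀ x ∈ N, ∀ a : A, op a • x ∈ N) (f : N →ₗ[ℂ] A) {C : ℝ} (hC : 0 ≤ C)
    (hf : ∀ (x : N) (a : A) (h : op a • (x : M) ∈ N), f ⟨_, h⟩ = f x * a)
    (hb : ∀ x, ‖f x‖ ≤ C * ‖x‖) (s : Finset N) {t : ℝ} (ht : 0 < t) :
    ∃ m : M, ‖m‖ ≤ C ∧ ∀ x ∈ s, ‖f x - ip A m x‖ ≤ C * √t := by
  -- T maps M into N. With R = (t + T)⁻¹, the contraction TR nearly fixes the vectors of s, and m is
  -- built so that ⟨m|x⟩ = f(TRx).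
  set T : M →L[ℂ] M := ∑ x ∈ s, rankOne A (x : M) with hT
  have hTx : ∀ y, T y = ∑ x ∈ s, op (ip A (x : M) y) • (x : M) := fun y => by
    rw [hT, sum_apply]; rfl
  have hTs : IsAdjointPair A T T := fun x y => by
    simp only [hT, sum_apply, ip_sum_left, ip_sum_right]
    exact Finset.sum_congr rfl fun z _ => rankOne_symm _ x y
  have hTip : ∀ y, ip A y (T y) = ∑ x ∈ s, star (ip A (x : M) y) * ip A (x : M) y := fun y => by
    simp only [hT, sum_apply, ip_sum_right, ip_rankOne]
  have hTpos : ∀ y, 0 ≤ ip A y (T y) := fun y => by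
    rw [hTip]; exact Finset.sum_nonneg fun x _ => star_mul_self_nonneg _
  have hTN : ∀ y, T y ∈ N := fun y => by
    rw [hTx]; exact Submodule.sum_mem _ fun x _ => hact x x.2 _
  obtain ⟨R, hRs, hR⟩ := exists_resolvent hTs hTpos ht
  have hfT : ∀ y, f ⟨T y, hTN y⟩ = ∑ x ∈ s, f x * ip A (x : M) y := fun y => by
    have e : (⟨T y, hTN y⟩ : N) = ∑ x ∈ s, ⟨op (ip A (x : M) y) • (x : M), hact x x.2 _⟩ :=
      Subtype.ext (by rw [Submodule.coe_sum]; exact hTx y)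
    rw [e, map_sum]
    exact Finset.sum_congr rfl fun x _ => hf x _ _
  set m : M := ∑ x ∈ s, op (star (f x)) • R x with hm
  have hmx : ∀ x, ip A m x = f ⟨T (R x), hTN _⟩ := fun x => by
    rw [hfT, hm, ip_sum_left]
    refine Finset.sum_congr rfl fun z _ => ?_
    rw [ip_act_left, star_star, hRs]
  refine ⟨m, norm_le_of_ip_le (A := A) hC fun x => ?_, fun x hx => ?_⟩
  · rw [hmx]
    refine (hb _).trans ?_
    gcongr
    -- In the expansion of ⟨x|x⟩ for x = tRx + TRx, all terms besides ⟨TRx|TRx⟩ are positive.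
    have h1 : ip A (T (R x)) (T (R x)) ≤ ((1 : ℝ) ^ 2) • ip A x x := by
      have e : ip A x x = (t * t) • ip A (R x) (R x) + (2 * t) • ip A (R x) (T (R x))
          + ip A (T (R x)) (T (R x)) := by
        have h2 : ip A x x = ip A ((t : ℂ) • R x + T (R x)) ((t : ℂ) • R x + T (R x)) := by
          rw [hR]
        rw [h2]
        simp only [ip_add_left, ip_add_right, ip_smul_left, ip_smul_right, Complex.star_def,
          Complex.conj_ofReal, ← hTs (R x) (R x)]
        simp only [Complex.coe_smul]
        module
      rw [one_pow, one_smul, e]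
      exact le_add_of_nonneg_left (add_nonneg (smul_nonneg (by positivity) (ip_self_nonneg A _))
        (smul_nonneg (by positivity) (hTpos _)))
    simpa using norm_le_of_ip_self_le (A := A) zero_le_one h1
  · have e : f x - ip A m x = f ((t : ℂ) • ⟨R x, by
        have h3 : R x = ((t : ℂ)⁻¹) • ((x : M) - T (R x)) := by
          nth_rewrite 2 [← hR x]
          rw [add_sub_cancel_right, smul_smul, inv_mul_cancel₀ (by exact_mod_cast ht.ne'), one_smul]
        rw [h3]
        exact N.smul_mem _ (N.sub_mem x.2 (hTN _))⟩) := by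
      rw [hmx, ← map_sub]
      congr 1
      refine Subtype.ext ?_
      have := hR x
      rw [← eq_sub_iff_add_eq] at this
      exact this.symm
    rw [e]
    refine (hb _).trans ?_
    gcongr
    rw [norm_smul, Complex.norm_real, Real.norm_of_nonneg ht.le]
    change t * ‖R x‖ ≤ √t
    -- For x in s, a*a is one summand of ⟨Rx|TRx⟩ ≤ a, so ‖a‖ ≤ 1. Then t⟨Rx|Rx⟩ ≤ a gives t‖Rx‖² ≤
    -- 1, so the error vector tRx has norm at most √t.
    set a := ip A (x : M) (R x) with ha
    have ha1 : a = t • ip A (R x) (R x) + ip A (R x) (T (R x)) := by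
      rw [ha]
      conv_lhs => rw [← hR x]
      rw [ip_add_left, ip_smul_left, Complex.star_def, Complex.conj_ofReal, Complex.coe_smul,
        hTs, hR]
    have ha2 : star a * a ≤ ip A (R x) (T (R x)) := by
      rw [hTip]
      exact Finset.single_le_sum (f := fun z : N => star (ip A (z : M) (R x)) * ip A (z : M) (R x))
        (fun z _ => star_mul_self_nonneg _) hx
    have hG : 0 ≤ t • ip A (R x) (R x) := smul_nonneg ht.le (ip_self_nonneg A _)
    have ha3 : star a * a ≤ a := by
      conv_rhs => rw [ha1]
      exact ha2.trans (le_add_of_nonneg_left hG)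
    have ha4 : ‖a‖ ≤ 1 := by
      have := CStarAlgebra.norm_le_norm_of_nonneg_of_le (star_mul_self_nonneg a) ha3
      rw [CStarRing.norm_star_mul_self] at this
      by_contra hcon
      push Not at hcon
      nlinarith
    have ha5 : t * ‖R x‖ ^ 2 ≤ 1 := by
      have h4 : t • ip A (R x) (R x) ≤ a := by
        conv_rhs => rw [ha1]
        exact le_add_of_nonneg_right (hTpos _)
      have h5 := CStarAlgebra.norm_le_norm_of_nonneg_of_le hG h4
      rw [norm_smul, Real.norm_of_nonneg ht.le, ← norm_sq_eq] at h5
      exact h5.trans ha4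
    refine Real.le_sqrt_of_sq_le ?_
    nlinarith

end Resolvent

/-! ### Weak limits, normal functionals and representation over W*-algebras. -/

section WStar

open Filter Topology InnerProductSpace

/-- A faithful representation whose image is a von Neumann algebra. -/
structure IsVonNeumannRep {A H : Type*} [NonUnitalCStarAlgebra A] [NormedAddCommGroup H]
    [InnerProductSpace ℂ H] [CompleteSpace H] (ρ : A →⋆ₙₐ[ℂ] (H →L[ℂ] H)) : Prop where
  injective : Function.Injective ρ
  exists_of_commute : ∀ T : H →L[ℂ] H, (∀ R : H →L[ℂ] H, (∀ a, ρ a * R = R * ρ a) → R * T = T * R) →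
    ∃ a, ρ a = T

lemma IsWStarAlgebra.exists_rep {A : Type u} [NonUnitalCStarAlgebra A] (hA : IsWStarAlgebra A) :
    ∃ (H : Type u) (_ : NormedAddCommGroup H) (_ : InnerProductSpace ℂ H) (_ : CompleteSpace H)
      (ρ : A →⋆ₙₐ[ℂ] (H →L[ℂ] H)), IsVonNeumannRep ρ := by
  obtain ⟨H, _, _, _, N, ⟨e⟩⟩ := hA
  let ρ : A →⋆ₙₐ[ℂ] (H →L[ℂ] H) :=
    { toFun := fun a => (e a : H →L[ℂ] H)
      map_smul' := fun c a => by rw [map_smul]; rfl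
      map_zero' := by rw [map_zero]; rfl
      map_add' := fun a b => by rw [map_add]; rfl
      map_mul' := fun a b => by rw [map_mul]; rfl
      map_star' := fun a => by rw [map_star]; rfl }
  refine ⟨H, _, _, _, ρ, ⟨fun a b h => e.injective (Subtype.ext h), fun T hT => ?_⟩⟩
  have hmem : T ∈ N.toStarSubalgebra := by
    rw [VonNeumannAlgebra.mem_carrier, ← N.centralizer_centralizer]
    refine Set.mem_centralizer_iff.2 fun R hR => hT R fun a => ?_
    exact Set.mem_centralizer_iff.1 hR _ (e a).2
  exact ⟨e.symm ⟨T, hmem⟩, congrArg Subtype.val (e.apply_symm_apply ⟨T, hmem⟩)⟩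

variable {A H : Type*} [NonUnitalCStarAlgebra A] [NormedAddCommGroup H]
  [InnerProductSpace ℂ H] [CompleteSpace H] {ρ : A →⋆ₙₐ[ℂ] (H →L[ℂ] H)}

lemma IsVonNeumannRep.norm_map (hρ : IsVonNeumannRep ρ) (a : A) : ‖ρ a‖ = ‖a‖ :=
  NonUnitalStarAlgHom.norm_map ρ hρ.injective a

lemma IsVonNeumannRep.ext (hρ : IsVonNeumannRep ρ) {a b : A}
    (h : ∀ ξ η, ⟪ξ, ρ a η⟫_ℂ = ⟪ξ, ρ b η⟫_ℂ) : a = b :=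
  hρ.injective (ContinuousLinearMap.ext fun η => ext_inner_left ℂ fun ξ => h ξ η)

/-- Bounded families converge weakly along ultrafilters. -/
lemma IsVonNeumannRep.exists_limit (hρ : IsVonNeumannRep ρ) {ι : Type*} (l : Ultrafilter ι)
    (a : ι → A) {C : ℝ} (hC : 0 ≤ C) (ha : ∀ᶠ i in l, ‖a i‖ ≤ C) :
    ∃ b : A, ‖b‖ ≤ C ∧ ∀ ξ η, Tendsto (fun i => ⟪ξ, ρ (a i) η⟫_ℂ) l (𝓝 ⟪ξ, ρ b η⟫_ℂ) := by
  have hbd : ∀ ξ η, ∀ᶠ i in l, ‖⟪ξ, ρ (a i) η⟫_ℂ‖ ≤ C * ‖ξ‖ * ‖η‖ := by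
    intro ξ η
    filter_upwards [ha] with i hi
    calc ‖⟪ξ, ρ (a i) η⟫_ℂ‖ ≤ ‖ξ‖ * ‖ρ (a i) η‖ := norm_inner_le_norm _ _
      _ ≤ ‖ξ‖ * (C * ‖η‖) := by
        gcongr
        refine ((ρ (a i)).le_opNorm η).trans ?_
        rw [hρ.norm_map]
        gcongr
      _ = C * ‖ξ‖ * ‖η‖ := by ring
  have hlim : ∀ ξ η, ∃ z : ℂ, ‖z‖ ≤ C * ‖ξ‖ * ‖η‖ ∧
      Tendsto (fun i => ⟪ξ, ρ (a i) η⟫_ℂ) l (𝓝 z) := by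
    intro ξ η
    have hK : IsCompact (Metric.closedBall (0 : ℂ) (C * ‖ξ‖ * ‖η‖)) := isCompact_closedBall _ _
    obtain ⟨z, hz, hzl⟩ := hK.ultrafilter_le_nhds (l.map fun i => ⟪ξ, ρ (a i) η⟫_ℂ) (by
      rw [le_principal_iff, Ultrafilter.coe_map, mem_map]
      filter_upwards [hbd ξ η] with i hi
      simpa using hi)
    exact ⟨z, by simpa using hz, hzl⟩
  choose L hLn hL using hlim
  have huniq : ∀ {ξ η z}, Tendsto (fun i => ⟪ξ, ρ (a i) η⟫_ℂ) l (𝓝 z) → L ξ η = z :=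
    fun h => tendsto_nhds_unique (hL _ _) h
  let Q : H →L⋆[ℂ] H →L[ℂ] ℂ := LinearMap.mkContinuous₂
    (LinearMap.mk₂'ₛₗ (starRingEnd ℂ) (RingHom.id ℂ) L
      (fun ξ ξ' η => huniq (by simpa only [inner_add_left] using (hL ξ η).add (hL ξ' η)))
      (fun c ξ η => huniq (by
        simpa only [inner_smul_left, smul_eq_mul] using (hL ξ η).const_mul ((starRingEnd ℂ) c)))
      (fun ξ η η' => huniq (by
        simpa only [map_add, inner_add_right] using (hL ξ η).add (hL ξ η')))
      (fun c ξ η => huniq (by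
        simpa only [map_smul, inner_smul_right, smul_eq_mul, RingHom.id_apply]
          using (hL ξ η).const_mul c))) C hLn
  have hQ : ∀ ξ η, Q ξ η = L ξ η := fun _ _ => rfl
  set T : H →L[ℂ] H := ContinuousLinearMap.adjoint (continuousLinearMapOfBilin Q) with hTdef
  have hT : ∀ ξ η, ⟪ξ, T η⟫_ℂ = L ξ η := fun ξ η => by
    rw [hTdef, ContinuousLinearMap.adjoint_inner_right, continuousLinearMapOfBilin_apply, hQ]
  -- Commuting with a fixed R passes to weak limits, so T lies in the bicommutant of the image.
  obtain ⟨b, hb⟩ := hρ.exists_of_commute T fun R hR => by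
    refine ContinuousLinearMap.ext fun η => ext_inner_left ℂ fun ξ => ?_
    rw [mul_apply_eq_comp, mul_apply_eq_comp, hT, ← ContinuousLinearMap.adjoint_inner_left, hT]
    refine huniq ?_
    have h1 := hL ξ (R η)
    refine h1.congr fun i => ?_
    rw [ContinuousLinearMap.adjoint_inner_left]
    have := DFunLike.congr_fun (hR (a i)) η
    rw [mul_apply_eq_comp, mul_apply_eq_comp] at this
    rw [this]
  refine ⟨b, ?_, fun ξ η => by rw [hb, hT]; exact hL ξ η⟩
  rw [← hρ.norm_map, hb]
  refine T.opNorm_le_bound hC fun η => ?_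
  have h1 : ‖⟪T η, T η⟫_ℂ‖ ≤ C * ‖T η‖ * ‖η‖ := by rw [hT]; exact hLn _ _
  rw [inner_self_eq_norm_sq_to_K] at h1
  have h2 : ‖T η‖ ^ 2 ≤ C * ‖T η‖ * ‖η‖ := by simpa using h1
  rcases (norm_nonneg (T η)).eq_or_lt with h0 | h0
  · rw [← h0]; positivity
  · nlinarith

variable [PartialOrder A] [StarOrderedRing A]

/-- Positivity in `A` is positivity of the represented operators. -/
lemma IsVonNeumannRep.nonneg (hρ : IsVonNeumannRep ρ) {a : A} (ha : IsSelfAdjoint a)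
    (h : ∀ ξ, 0 ≤ ⟪ξ, ρ a ξ⟫_ℂ) : 0 ≤ a := by
  have hn : IsSelfAdjoint a⁻ := .of_nonneg (CFC.negPart_nonneg a)
  -- Testing positivity on the vectors ρ(a⁻)ξ shows −(a⁻)³ ≥ 0, which forces (a⁻)³ = 0 and then a⁻ =
  -- 0.
  have e1 : a⁻ * a * a⁻ = -(a⁻ * a⁻ * a⁻) := by
    have : a⁻ * a = -(a⁻ * a⁻) := by
      calc a⁻ * a = a⁻ * (a⁺ - a⁻) := by rw [CFC.posPart_sub_negPart a ha]
        _ = -(a⁻ * a⁻) := by rw [mul_sub, CFC.negPart_mul_posPart, zero_sub]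
    rw [this, neg_mul]
  have hsq : 0 ≤ a⁻ * a⁻ * a⁻ := by
    have := star_left_conjugate_nonneg (CFC.negPart_nonneg a) a⁻
    rwa [hn.star_eq] at this
  have hz : a⁻ * a⁻ * a⁻ = 0 := by
    obtain ⟨c, hc⟩ := CStarAlgebra.nonneg_iff_eq_star_mul_self.1 hsq
    have hc0 : ρ c = 0 := by
      refine ContinuousLinearMap.ext fun ξ => ?_
      have h1 := h (ρ a⁻ ξ)
      have hadj : ∀ (x : A) (ξ η : H), ⟪ρ x ξ, η⟫_ℂ = ⟪ξ, ρ (star x) η⟫_ℂ := fun x ξ η => by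
        rw [map_star, ContinuousLinearMap.star_eq_adjoint, ContinuousLinearMap.adjoint_inner_right]
      rw [hadj, hn.star_eq, ← mul_apply_eq_comp, ← mul_apply_eq_comp, ← map_mul, ← map_mul,
        e1, hc, map_neg, neg_apply, inner_neg_right, map_mul, mul_apply_eq_comp,
        ← hadj, inner_self_eq_norm_sq_to_K] at h1
      have h2 : (0 : ℂ) ≤ ((-(‖ρ c ξ‖ ^ 2) : ℝ) : ℂ) := by simpa using! h1
      have h3 : 0 ≤ -(‖ρ c ξ‖ ^ 2) := by exact_mod_cast h2
      have h4 : ‖ρ c ξ‖ = 0 := by nlinarith [sq_nonneg ‖ρ c ξ‖, norm_nonneg (ρ c ξ)]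
      simpa using h4
    have : c = 0 := hρ.injective (by rw [hc0, map_zero])
    rw [hc, this, mul_zero]
  have hz1 : a⁻ = 0 := by
    have h5 : star (a⁻ * a⁻) * (a⁻ * a⁻) = 0 := by
      rw [star_mul, hn.star_eq, ← mul_assoc, hz, zero_mul]
    have h6 : star a⁻ * a⁻ = 0 := by
      rw [hn.star_eq]; exact CStarRing.star_mul_self_eq_zero_iff _ |>.1 h5
    exact CStarRing.star_mul_self_eq_zero_iff _ |>.1 h6
  rw [← CFC.posPart_sub_negPart a ha, hz1, sub_zero]
  exact CFC.posPart_nonneg a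

/-- The vector functional `a ↦ ⟨ξ|ρ(a)ξ⟩`. -/
def vectorFunctional (ρ : A →⋆ₙₐ[ℂ] (H →L[ℂ] H)) (ξ : H) : A →ₚ[ℂ] ℂ :=
  PositiveLinearMap.mk₀
    { toFun := fun a => ⟪ξ, ρ a ξ⟫_ℂ
      map_add' := fun a b => by rw [map_add, add_apply, inner_add_right]
      map_smul' := fun c a => by rw [map_smul, smul_apply, inner_smul_right]; rfl } fun a ha => by
    obtain ⟨c, rfl⟩ := CStarAlgebra.nonneg_iff_eq_star_mul_self.1 ha
    simp only [LinearMap.coe_mk, AddHom.coe_mk]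
    rw [map_mul, mul_apply_eq_comp, map_star, ContinuousLinearMap.star_eq_adjoint,
      ContinuousLinearMap.adjoint_inner_right, inner_self_eq_norm_sq_to_K]
    simp

/-- The increasing net is bounded from some index on, so it has a weak limit b along an ultrafilter.
As b is an upper bound of D, s ≤ b; and ⟨ξ|ρ(b)ξ⟩ is a limit of values at elements of D. -/
lemma IsVonNeumannRep.isNormal_vectorFunctional (hρ : IsVonNeumannRep ρ) (ξ : H) :
    IsNormalMap (vectorFunctional ρ ξ) := by
  intro D hDne hDdir hDsa s hs
  refine ⟨?_, fun z hz => ?_⟩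
  · rintro _ ⟨a, ha, rfl⟩
    exact OrderHomClass.mono (vectorFunctional ρ ξ) (hs.1 ha)
  obtain ⟨a₀, ha₀⟩ := hDne
  have : Nonempty D := ⟨⟨a₀, ha₀⟩⟩
  have : IsDirectedOrder D := ⟨fun x y => by
    obtain ⟨c, hc, h1, h2⟩ := hDdir x x.2 y y.2
    exact ⟨⟨c, hc⟩, h1, h2⟩⟩
  let l : Ultrafilter D := Ultrafilter.of atTop
  have hl : (l : Filter D) ≤ atTop := Ultrafilter.of_le _
  have htail : ∀ a : D, ∀ᶠ i in (l : Filter D), a ≤ i := fun a => hl (eventually_ge_atTop a)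
  obtain ⟨b, -, hb⟩ := hρ.exists_limit l (fun i : D => (i : A)) (C := ‖s - a₀‖ + ‖a₀‖)
    (by positivity) (by
      filter_upwards [htail ⟨a₀, ha₀⟩] with i hi
      have h1 : ‖(i : A) - a₀‖ ≤ ‖s - a₀‖ := CStarAlgebra.norm_le_norm_of_nonneg_of_le
        (sub_nonneg.2 hi) (sub_le_sub_right (hs.1 i.2) _)
      calc ‖(i : A)‖ = ‖((i : A) - a₀) + a₀‖ := by rw [sub_add_cancel]
        _ ≤ ‖(i : A) - a₀‖ + ‖a₀‖ := norm_add_le _ _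
        _ ≤ _ := by gcongr)
  have hadj : ∀ (x : A) (ξ η : H), ⟪ξ, ρ (star x) η⟫_ℂ = ⟪ρ x ξ, η⟫_ℂ := fun x ξ η => by
    rw [map_star, ContinuousLinearMap.star_eq_adjoint, ContinuousLinearMap.adjoint_inner_right]
  have hbsa : IsSelfAdjoint b := hρ.ext fun ξ η => by
    have h1 := (hb η ξ).star
    have h2 : ∀ x : A, star ⟪η, ρ x ξ⟫_ℂ = ⟪ξ, ρ (star x) η⟫_ℂ := fun x => by
      rw [hadj]; exact inner_conj_symm _ _
    simp only [h2] at h1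
    refine tendsto_nhds_unique h1 ((hb ξ η).congr fun i => ?_)
    rw [(hDsa i i.2).star_eq]
  have hsb : s ≤ b := hs.2 fun a ha => by
    refine sub_nonneg.1 (hρ.nonneg (hbsa.sub (hDsa a ha)) fun η => ?_)
    rw [map_sub, sub_apply, inner_sub_right, sub_nonneg]
    refine ge_of_tendsto (hb η η) ?_
    filter_upwards [htail ⟨a, ha⟩] with i hi
    exact OrderHomClass.mono (vectorFunctional ρ η) hi
  refine (OrderHomClass.mono (vectorFunctional ρ ξ) hsb).trans ?_
  exact le_of_tendsto' (hb ξ ξ) fun i => hz ⟨i, i.2, rfl⟩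

/-- The vector functionals separate the points of `A`. -/
lemma IsVonNeumannRep.exists_vectorFunctional_ne_zero (hρ : IsVonNeumannRep ρ) {a : A}
    (ha : a ≠ 0) : ∃ ξ, vectorFunctional ρ ξ a ≠ 0 := by
  by_contra! h
  refine ha (hρ.injective ?_)
  rw [map_zero]
  have := (inner_map_self_eq_zero (ρ a).toLinearMap).1 fun ξ => by
    exact inner_eq_zero_symm.1 (h ξ)
  exact ContinuousLinearMap.coe_injective this

variable {M : Type*} [NormedAddCommGroup M] [NormedSpace ℂ M] [SMul Aᵐᵒᵖ M] [CStarModule Aᵐᵒᵖ M]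

/-- Over a W⋆-algebra, functionals on submodules of a self-dual module are represented. -/
lemma hasRepresentation_of_isWStarAlgebra [CompleteSpace M] (hA : IsWStarAlgebra A)
    (hM : IsSelfDual A M) {N : Submodule ℂ M} (hact : ∀ x ∈ N, ∀ a : A, op a • x ∈ N) :
    HasRepresentation A N := by
  classical
  obtain ⟨H, _, _, _, ρ, hρ⟩ := hA.exists_rep
  intro f C hC hf hb
  have happ : ∀ i : Finset N × ℕ, ∃ m : M, ‖m‖ ≤ C ∧
      ∀ x ∈ i.1, ‖f x - ip A m x‖ ≤ C * √(1 / ((i.2 : ℝ) + 1)) := fun i =>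
    exists_approx_representation hact f hC hf hb i.1 (by positivity)
  choose m hm hmf using happ
  let l : Ultrafilter (Finset N × ℕ) := Ultrafilter.of atTop
  have hl : (l : Filter (Finset N × ℕ)) ≤ atTop := Ultrafilter.of_le _
  have hlim : ∀ x : M, ∃ b : A, ‖b‖ ≤ C * ‖x‖ ∧
      ∀ ξ η, Tendsto (fun i => ⟪ξ, ρ (ip A (m i) x) η⟫_ℂ) l (𝓝 ⟪ξ, ρ b η⟫_ℂ) := fun x =>
    hρ.exists_limit l (fun i => ip A (m i) x) (by positivity) (Eventually.of_forall fun i =>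
      (norm_ip_le A _ _).trans (by gcongr; exact hm i))
  choose F hFn hF using hlim
  have huniq : ∀ {x b}, (∀ ξ η, Tendsto (fun i => ⟪ξ, ρ (ip A (m i) x) η⟫_ℂ) l
      (𝓝 ⟪ξ, ρ b η⟫_ℂ)) → F x = b := fun h =>
    hρ.ext fun ξ η => tendsto_nhds_unique (hF _ ξ η) (h ξ η)
  let F₁ : M →L[ℂ] A := LinearMap.mkContinuous
    { toFun := F
      map_add' := fun x y => huniq fun ξ η => by
        simpa only [ip_add_right, map_add, add_apply, inner_add_right]
          using (hF x ξ η).add (hF y ξ η)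
      map_smul' := fun c x => huniq fun ξ η => by
        simpa only [ip_smul_right, map_smul, smul_apply, inner_smul_right, RingHom.id_apply]
          using (hF x ξ η).const_mul c } C hFn
  -- The weak limit of the functionals ⟨m i|·⟩ stays A-linear, as ρ(a) can be absorbed into η, so
  -- self-duality applies.
  obtain ⟨z, hz⟩ := hM F₁ fun x a => huniq fun ξ η => by
    simpa only [ip_act_right, map_mul, mul_apply_eq_comp] using! hF x ξ (ρ a η)
  have hz' : ∀ x, F x = ip A z x := hz
  refine ⟨z, norm_le_of_ip_le (A := A) hC fun y => by rw [← hz']; exact hFn y, fun x => ?_⟩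
  rw [← hz']
  refine (huniq fun ξ η => ?_).symm
  have h1 : Tendsto (fun i : Finset N × ℕ => f x - ip A (m i) x) atTop (𝓝 0) := by
    have h2 : Tendsto (fun i : Finset N × ℕ => C * √(1 / ((i.2 : ℝ) + 1))) atTop (𝓝 0) := by
      have h3 : Tendsto (fun n : ℕ => C * √(1 / ((n : ℝ) + 1))) atTop (𝓝 (C * √0)) :=
        ((Real.continuous_sqrt.tendsto 0).comp tendsto_one_div_add_atTop_nhds_zero_nat).const_mul C
      rw [Real.sqrt_zero, mul_zero] at h3
      have h4 : Tendsto (Prod.snd : Finset N × ℕ → ℕ) atTop atTop := by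
        rw [← prod_atTop_atTop_eq]; exact tendsto_snd
      exact h3.comp h4
    refine squeeze_zero_norm' ?_ h2
    filter_upwards [eventually_ge_atTop (({x} : Finset N), 0)] with i hi
    exact hmf i x (hi.1 (Finset.mem_singleton_self x))
  have h5 : Tendsto (fun i : Finset N × ℕ => ip A (m i) x) l (𝓝 (f x)) := by
    have := (tendsto_const_nhds (x := f x)).sub (h1.mono_left hl)
    simpa only [sub_sub_cancel, sub_zero] using this
  have hcont : Continuous fun a : A => ⟪ξ, ρ a η⟫_ℂ := by
    have hρc : Continuous ρ :=
      (AddMonoidHomClass.isometry_of_norm ρ hρ.norm_map).continuous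
    exact continuous_const.inner (hρc.clm_apply continuous_const)
  exact (hcont.tendsto _).comp h5

/-- Subspaces dense for one of the two weak topologies are total. -/
lemma isTotal_of_dense_tau (hA : IsWStarAlgebra A) {N : Submodule ℂ M}
    (hN : @Dense M (tau₁ A M) (N : Set M) ∨ @Dense M (tau₂ A M) (N : Set M)) : IsTotal A N := by
  obtain ⟨H, _, _, _, ρ, hρ⟩ := hA.exists_rep
  intro z hz
  by_contra hz0
  obtain ⟨ξ, hξ⟩ := hρ.exists_vectorFunctional_ne_zero
    (fun h => hz0 (eq_zero_of_ip_self h) : ip A z z ≠ 0)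
  set φ := vectorFunctional ρ ξ with hφ
  have hφn : IsNormalMap φ := hρ.isNormal_vectorFunctional ξ
  have hpos : ∀ x : M, 0 ≤ φ (ip A x x) := fun x => by
    have := OrderHomClass.mono φ (ip_self_nonneg A x)
    rwa [map_zero] at this
  have hre : ∀ x : M, 0 ≤ (φ (ip A x x)).re := fun x => (Complex.le_def.1 (hpos x)).1
  have hzpos : 0 < (φ (ip A z z)).re := by
    refine lt_of_le_of_ne (hre z) fun h => hξ ?_
    exact Complex.ext h.symm (Complex.le_def.1 (hpos z)).2.symm
  -- Each topology has an open set around z missing N: for x in N orthogonal to z, φ⟨x−z|x−z⟩ =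
  -- φ⟨x|x⟩ + φ⟨z|z⟩ in the first case and φ⟨z|x−z⟩ = −φ⟨z|z⟩ in the second.
  rcases hN with hN | hN
  · obtain ⟨x, hx, hxN⟩ := (@dense_iff_inter_open M (tau₁ A M) _).1 hN
      {x | √(φ (ip A (x - z) (x - z))).re < √(φ (ip A z z)).re}
      (TopologicalSpace.isOpen_generateFrom_of_mem ⟨φ, z, _, hφn, rfl⟩)
      ⟨z, by simpa [ip_zero_left] using hzpos⟩
    have h1 := hz x hxN
    have h2 : ip A x z = 0 := by rw [← star_ip, h1, star_zero]
    have hx' : √(φ (ip A (x - z) (x - z))).re < √(φ (ip A z z)).re := hx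
    have h3 := (Real.sqrt_lt_sqrt_iff (hre _)).1 hx'
    rw [ip_sub_left, ip_sub_right, ip_sub_right, h1, h2, sub_zero, zero_sub, sub_neg_eq_add,
      map_add, Complex.add_re] at h3
    linarith [hre x]
  · obtain ⟨x, hx, hxN⟩ := (@dense_iff_inter_open M (tau₂ A M) _).1 hN
      {x | ‖φ (ip A z (x - z))‖ < ‖φ (ip A z z)‖}
      (TopologicalSpace.isOpen_generateFrom_of_mem ⟨φ, z, z, _, hφn, rfl⟩)
      ⟨z, by simpa [ip_zero_right] using hξ⟩
    have hx' : ‖φ (ip A z (x - z))‖ < ‖φ (ip A z z)‖ := hx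
    rw [ip_sub_right, hz x hxN, zero_sub, map_neg, norm_neg] at hx'
    exact lt_irrefl _ hx'

end WStar

/-! ### Normal maps form a face. -/

section Normal

/-- A positive map dominated by a normal one is normal. -/
lemma IsNormalMap.of_dominated {A B : Type*} [NonUnitalCStarAlgebra A] [PartialOrder A]
    [StarOrderedRing A] [CStarAlgebra B] [PartialOrder B] [StarOrderedRing B]
    {f f' : B →ₗ[ℂ] A} {t t' : ℝ} (ht : 0 < t) (ht' : 0 ≤ t') (hf : ∀ b, 0 ≤ b → 0 ≤ f b)
    (hf' : ∀ b, 0 ≤ b → 0 ≤ f' b) (h : IsNormalMap fun b => t • f b + t' • f' b) :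
    IsNormalMap f := by
  intro D hne hdir hsa s hs
  have hmono : ∀ {b c}, b ≤ c → f b ≤ f c := fun {b c} hbc => by
    have := hf (c - b) (sub_nonneg.2 hbc)
    rwa [map_sub, sub_nonneg] at this
  have hmono' : ∀ {b c}, b ≤ c → f' b ≤ f' c := fun {b c} hbc => by
    have := hf' (c - b) (sub_nonneg.2 hbc)
    rwa [map_sub, sub_nonneg] at this
  refine ⟨?_, fun z hz => ?_⟩
  · rintro _ ⟨b, hb, rfl⟩
    exact hmono (hs.1 hb)
  -- If z bounds f on D, then tz + t'f'(s) bounds the normal sum on D, hence at s; the term t'f'(s)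
  -- cancels.
  have h1 : t • f s + t' • f' s ≤ t • z + t' • f' s := by
    refine (h D hne hdir hsa s hs).2 ?_
    rintro _ ⟨b, hb, rfl⟩
    exact add_le_add (smul_le_smul_of_nonneg_left (hz ⟨b, hb, rfl⟩) ht.le)
      (smul_le_smul_of_nonneg_left (hmono' (hs.1 hb)) ht')
  have h2 := le_of_add_le_add_right h1
  have h3 := smul_le_smul_of_nonneg_left h2 (inv_nonneg.2 ht.le)
  rwa [smul_smul, smul_smul, inv_mul_cancel₀ ht.ne', one_smul, one_smul] at h3

variable {A B V G : Type*} [NonUnitalCStarAlgebra A] [PartialOrder A] [StarOrderedRing A]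
  [CStarAlgebra B] [PartialOrder B] [StarOrderedRing B] [AddCommGroup V] [Module ℂ V]
  [SMul Aᵐᵒᵖ V] [Group G]

/-- The set of normal maps is a face. -/
lemma extreme_NCP_iff (β : G →* (B ≃⋆ₐ[ℂ] B)) (U : G →* (V ≃ₗ[ℂ] V)) (s₁ : SesqForm A V)
    {S : B →ₗ[ℂ] SesqForm A V} (hS : S ∈ NCP β U s₁) :
    S ∈ (NCP β U s₁).extremePoints ℝ ↔ S ∈ (CP β U s₁).extremePoints ℝ := by
  have aux : ∀ {R R' : B →ₗ[ℂ] SesqForm A V} {t t' : ℝ}, R ∈ CP β U s₁ → R' ∈ CP β U s₁ → 0 < t →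
      0 < t' → t • R + t' • R' = S → R ∈ NCP β U s₁ := by
    intro R R' t t' hR hR' ht ht' h
    refine ⟨hR, fun v => ?_⟩
    let diag : (B →ₗ[ℂ] SesqForm A V) → B →ₗ[ℂ] A := fun R =>
      { toFun := fun b => (R b).1 v v
        map_add' := fun b c => by rw [map_add]; rfl
        map_smul' := fun c b => by rw [map_smul]; rfl }
    refine IsNormalMap.of_dominated (f := diag R) (f' := diag R') ht ht'.le
      (fun b hb => hR.1.nonneg hb v) (fun b hb => hR'.1.nonneg hb v) ?_
    have := hS.2 v
    rw [← h] at this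
    exact this
  rw [mem_extremePoints, mem_extremePoints]
  constructor
  · rintro ⟨-, hext⟩
    refine ⟨hS.1, ?_⟩
    rintro R hR R' hR' ⟨t, t', ht, ht', htt, h⟩
    exact hext R (aux hR hR' ht ht' h) R' (aux hR' hR ht' ht (by rw [add_comm]; exact h))
      ⟨t, t', ht, ht', htt, h⟩
  · rintro ⟨-, hext⟩
    exact ⟨hS, fun R hR R' hR' h => hext R hR.1 R' hR'.1 h⟩

end Normal

end CovCP

end

/-! ### The theorem. -/

theorem mainTheorem3 {A : Type*} {B : Type*} {V : Type*} {G : Type*}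
    [NonUnitalCStarAlgebra A] [PartialOrder A] [StarOrderedRing A]
    [CStarAlgebra B] [PartialOrder B] [StarOrderedRing B]
    [AddCommGroup V] [Module ℂ V] [SMul Aᵐᵒᵖ V] [CovCP.IsRightModule A V] [Group G]
    (β : G →* (B ≃⋆ₐ[ℂ] B))
    (U : G →* (V ≃ₗ[ℂ] V)) (hU : ∀ g, CovCP.IsModuleMap A (U g))
    (s₁ : CovCP.SesqForm A V) (hs₁ : CovCP.SesqForm.IsPositive s₁)
    (S : B →ₗ[ℂ] CovCP.SesqForm A V) (hS : S ∈ CovCP.CP β U s₁) :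
    -- minimal dilations over a C⋆-algebra
    (∀ (M : Type*) [NormedAddCommGroup M] [NormedSpace ℂ M] [CompleteSpace M]
      [SMul Aᵐᵒᵖ M] [CStarModule Aᵐᵒᵖ M] (d : CovCP.CovariantDilation β U S M),
      d.IsMinimal →
        (S ∈ (CovCP.CP β U s₁).extremePoints ℝ → d.ExtremalityCondition) ∧
        (CovCP.IsSelfDual A M → d.ExtremalityCondition →
          S ∈ (CovCP.CP β U s₁).extremePoints ℝ)) ∧
    -- W⋆-minimal dilations over a W⋆-algebra
    (CovCP.IsWStarAlgebra A →
      ∀ (L : Type*) [NormedAddCommGroup L] [NormedSpace ℂ L] [CompleteSpace L]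
        [SMul Aᵐᵒᵖ L] [CStarModule Aᵐᵒᵖ L] (d : CovCP.CovariantDilation β U S L),
        d.IsWStarMinimal →
          (S ∈ (CovCP.CP β U s₁).extremePoints ℝ ↔ d.ExtremalityCondition)) ∧
    -- normal maps
    (CovCP.IsWStarAlgebra A → CovCP.IsWStarAlgebra B → S ∈ CovCP.NCP β U s₁ →
      (S ∈ (CovCP.NCP β U s₁).extremePoints ℝ ↔ S ∈ (CovCP.CP β U s₁).extremePoints ℝ)) := by
  refine ⟨fun M _ _ _ _ _ d hd => ⟨fun h => ?_, fun hM h => ?_⟩, fun hA L _ _ _ _ _ d hd => ?_,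
    fun _ _ h => CovCP.extreme_NCP_iff β U s₁ h⟩
  · exact d.extremalityCondition_of_extreme h (CovCP.isTotal_of_dense hd)
  · exact d.extreme_of_extremalityCondition hS hM (CovCP.isTotal_of_dense hd)
      (CovCP.hasRepresentation_of_dense hM d.act_mem_range hd) h
  · have hN := CovCP.isTotal_of_dense_tau hA hd.2
    exact ⟨fun h => d.extremalityCondition_of_extreme h hN, fun h =>
      d.extreme_of_extremalityCondition hS hd.1 hN
        (CovCP.hasRepresentation_of_isWStarAlgebra hA hd.1 d.act_mem_range) h⟩
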